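/- **Conventions.** A snark is a finite simple bridgeless cubic graph that is not $3$-edge-colorable. For a proper edge-coloring $\sigma$ of a cubic graph (or cubic multipole, i.e. a graph with semiedges) let $\sigma(v)$ be the set of colors of the edges and semiedges at the vertex $v$. The coloring is *normal* if $|\sigma(u)\cup\sigma(v)|\in\{3,5\}$ for every edge $uv$. Normal $5$-edge-colorings use colors $1,\dots,5$. **Superedges.** Let $H$ be a snark and $x,y$ two distinct nonadjacent vertices of $H$. The superedge $H_{x,y}$ is obtained by removing $x$ and $y$ and turning the three edges of $H$ at $x$ into the *left semiedges* $s^l_1,s^l_2,s^l_3$ and the three edges at $y$ into the *right semiedges* $s^r_1,s^r_2,s^r_3$. In a normal $5$-edge-coloring $c$ of $H_{x,y}$ the color scheme of a semiedge $s$ with end-vertex $v$ is $c[s]=(a,\{b,b'\})$ with $a=c(s)$ and $\{b,b'\}=c(v)\setminus\{a\}$; it is *consistent* with $(a_0,\{b_0,b_0'\})$ if $a=a_0$ and $\{b,b'\}$ equals $\{b_0,b_0'\}$ or $\{1,\dots,5\}\setminus\{a_0,b_0,b_0'\}$. A Kempe $(a,b)$-chain connecting two semiedges is a path that begins with one of them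 and ends with the other and whose edges, including these two semiedges, are colored alternately $a,b$, starting with $a$. * $H_{x,y}$ is *$j$-right* if it has a normal $5$-edge-coloring in which $s^l_j$ and all three right semiedges have schemes consistent with $(3,\{1,2\})$, the other two left semiedges have schemes consistent with $(2,\{1,3\})$, and these two left semiedges are connected by a Kempe $(2,1)$-chain. It is *doubly-right* if it is $j$-right for at least two distinct $j\in\{1,2,3\}$. * A *$j,k$-left coloring* of $H_{x,y}$ is a normal $5$-edge-coloring in which $s^l_j$ and $s^r_k$ have schemes consistent with $(3,\{1,2\})$, the other two left semiedges with $(1,\{2,3\})$, the other two right semiedges with $(2,\{1,3\})$, and the two left semiedges other than $s^l_j$ are connected by a Kempe $(1,2)$-chain. $H_{x,y}$ is *doubly-left* if for every $j\in\{1,2,3\}$ it has a $j,k$-left coloring for at least two distinct $k\in\{1,2,3\}$. **Superpositions.** Let $G$ be a snark and $C=u_0u_1\cdots u_{g-1}u_0$ a cycle of length $g\ge 3$ in $G$, indices modulo $g$. A superposition $\tilde G\in\mathcal G_C(\mathcal A,\mathcal B)$ is given, for each $i$, by a supervertex $\mathcal A_i\in\{A,A'\}$, a superedge $\mathcal B_i=H_{x,y}$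 (where $H,x,y$ may depend on $i$), a permutation $p_i$ of $\{1,2,3\}$ and a dock index $d_i\in\{1,2,3\}$. It is obtained from $G$ by deleting the edges $u_iu_{i+1}$ of $C$, adding disjoint copies of the $\mathcal B_i$, joining, for all $i$ and $k$, the right semiedge $s^r_k$ of $\mathcal B_i$ with the left semiedge $s^l_{p_i(k)}$ of $\mathcal B_{i+1}$ into one edge, and then, for every $i$, inserting the vertex $u_i$ of $G$ into the edge so formed at the left semiedge $s^l_{d_i}$ of $\mathcal B_i$ (so that $u_i$ keeps its edge of $G$ outside $C$). If $\mathcal A_i=A$ nothing more is done at $i$; if $\mathcal A_i=A'$ the two edges so formed at the other two left semiedges of $\mathcal B_i$ are each subdivided by a new vertex, and these two new vertices are joined by an edge. **Theorem.** Let $G$ be a snark with a normal $5$-edge-coloring $\sigma$, $C$ a cycle of length $g$ in $G$, and $\tilde G\in\mathcal G_C(\mathcal A,\mathcal B)$ a superposition of $G$. If the superedge $\mathcal B_i$ is both doubly-right and doubly-left for every $i=0,\dots,g-1$, then $\tilde G$ has a normal $5$-edge-coloring. -/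

import Mathlib

open Set

namespace SnarkSuperposition

/-! ### Cubic graphs, snarks and normal edge-colorings

An edge-coloring of a simple graph on `V` is given by a function on `Sym2 V`; only its values on
the edges of the graph matter. -/

/-- Every vertex has exactly three neighbours. -/
def IsCubic {V : Type*} (G : SimpleGraph V) : Prop :=
  ∀ v, (G.neighborSet v).ncard = 3

/-- Adjacent edges receive distinct colors. -/
def IsProperEdgeColoring {V κ : Type*} (G : SimpleGraph V) (c : Sym2 V → κ) : Prop :=
  ∀ v a b, G.Adj v a → G.Adj v b → a ≠ b → c s(v, a) ≠ c s(v, b)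

/-- A snark in the broad sense: a bridgeless cubic simple graph that is not 3-edge-colorable. -/
structure IsSnark {V : Type*} (G : SimpleGraph V) : Prop where
  cubic : IsCubic G
  bridgeless : ∀ e ∈ G.edgeSet, ¬ G.IsBridge e
  not_colorable : ¬ ∃ c : Sym2 V → Fin 3, IsProperEdgeColoring G c

/-- The set of colors `c(v)` of the edges incident to `v`. -/
def colorsAt {V κ : Type*} (G : SimpleGraph V) (c : Sym2 V → κ) (v : V) : Set κ :=
  {k | ∃ w, G.Adj v w ∧ c s(v, w) = k}

/-- The edge `vw` is poor or rich. -/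
def IsNormalEdge {V κ : Type*} (G : SimpleGraph V) (c : Sym2 V → κ) (v w : V) : Prop :=
  (colorsAt G c v ∪ colorsAt G c w).ncard = 3 ∨ (colorsAt G c v ∪ colorsAt G c w).ncard = 5

/-- A normal 5-edge-coloring. The five colors are `1, 2, 3, 4, 5`, read in `Fin 5` (so `5` is the
element `0`). -/
def IsNormalColoring {V : Type*} (G : SimpleGraph V) (c : Sym2 V → Fin 5) : Prop :=
  IsProperEdgeColoring G c ∧ ∀ v w, G.Adj v w → IsNormalEdge G c v w

/-! ### Multipoles and their colorings -/

/-- A multipole with vertex set `V` and set of semiedges `S`, all of whose semiedges are incident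
to a vertex (that is, without isolated edges). -/
structure Multipole (V S : Type*) where
  /-- the vertices and the edges -/
  graph : SimpleGraph V
  /-- the vertex a semiedge is incident to -/
  base : S → V

/-- An assignment of five colors to the edges and the semiedges of a multipole. -/
structure MultipoleColoring (V S : Type*) where
  edge : Sym2 V → Fin 5
  semi : S → Fin 5

namespace Multipole

variable {V S : Type*} (M : Multipole V S)

/-- Edges and semiedges sharing a vertex have distinct colors. -/
def IsProper (c : MultipoleColoring V S) : Prop :=
  IsProperEdgeColoring M.graph c.edge ∧
  (∀ s t, s ≠ t → M.base s = M.base t → c.semi s ≠ c.semi t) ∧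
  (∀ s w, M.graph.Adj (M.base s) w → c.semi s ≠ c.edge s(M.base s, w))

/-- The set of colors of the edges and semiedges incident to `v`. -/
def colorsAt (c : MultipoleColoring V S) (v : V) : Set (Fin 5) :=
  {k | (∃ w, M.graph.Adj v w ∧ c.edge s(v, w) = k) ∨ (∃ s, M.base s = v ∧ c.semi s = k)}

/-- A normal 5-edge-coloring of a cubic multipole: a proper coloring in which every edge is poor or
rich. -/
def IsNormal (c : MultipoleColoring V S) : Prop :=
  M.IsProper c ∧ ∀ v w, M.graph.Adj v w →
    (M.colorsAt c v ∪ M.colorsAt c w).ncard = 3 ∨ (M.colorsAt c v ∪ M.colorsAt c w).ncard = 5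

/-- The color scheme `(i, {j, k})` of a semiedge: its own color and the remaining colors at its
end-vertex. -/
def scheme (c : MultipoleColoring V S) (s : S) : Fin 5 × Set (Fin 5) :=
  (c.semi s, M.colorsAt c (M.base s) \ {c.semi s})

/-- The semiedges `s` and `t` are the two ends of a Kempe `(a, b)`-chain: a path all of whose edges,
including the semiedges `s` and `t` at its ends, have colors `a` and `b`, starting with color `a`
at `s`. (In a proper coloring the colors then alternate along the path.) -/
def IsKempeChainEnds (c : MultipoleColoring V S) (a b : Fin 5) (s t : S) : Prop :=
  s ≠ t ∧ c.semi s = a ∧ (c.semi t = a ∨ c.semi t = b) ∧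
  ∃ P : M.graph.Walk (M.base s) (M.base t), P.IsPath ∧ ∀ e ∈ P.edges, c.edge e = a ∨ c.edge e = b

end Multipole

/-- Color schemes of semiedges are consistent if the colors of the semiedges agree and the pairs of
remaining colors are equal or complementary. -/
def Consistent (f h : Fin 5 × Set (Fin 5)) : Prop :=
  f.1 = h.1 ∧ (f.2 = h.2 ∨ f.2 = ({h.1} ∪ h.2)ᶜ)

/-! ### Superedges `H_{x,y}`

The three left semiedges and the three right semiedges are both indexed by `Fin 3`; the set of all
semiedges is `Fin 3 ⊕ Fin 3`, with the left semiedges as `Sum.inl` and the right ones as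
`Sum.inr`. -/

/-- The data of a superedge `H_{x,y}`: a snark `H`, two nonadjacent vertices `x ≠ y` of `H`, and
a numbering of the left (resp. right) semiedges, i.e. of the edges of `H` at `x` (resp. `y`). -/
structure Superedge (W : Type*) where
  H : SimpleGraph W
  x : W
  y : W
  snark : IsSnark H
  ne : x ≠ y
  not_adj : ¬ H.Adj x y
  left : Fin 3 ≃ H.neighborSet x
  right : Fin 3 ≃ H.neighborSet y

namespace Superedge

variable {W : Type*} (B : Superedge W)

/-- The vertices of `H_{x,y}`: those of `H` other than `x` and `y`. -/
abbrev Inner : Type _ := {w : W // w ≠ B.x ∧ w ≠ B.y}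

/-- The vertex incident to the left semiedge number `j`. -/
def leftVertex (j : Fin 3) : B.Inner :=
  ⟨B.left j, (B.left j).2.ne', fun h => B.not_adj (h ▸ (B.left j).2)⟩

/-- The vertex incident to the right semiedge number `k`. -/
def rightVertex (k : Fin 3) : B.Inner :=
  ⟨B.right k, fun h => B.not_adj (h ▸ (B.right k).2).symm, (B.right k).2.ne'⟩

/-- The multipole `H_{x,y}`: the vertices `x` and `y` are removed, and the edges of `H` at `x` and
`y` become semiedges. -/
def multipole : Multipole B.Inner (Fin 3 ⊕ Fin 3) where
  graph := B.H.comap Subtype.val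
  base := Sum.elim B.leftVertex B.rightVertex

/-- The color scheme `κ_j` of a superedge. -/
def kappa (j : Fin 3) : Fin 3 ⊕ Fin 3 → Fin 5 × Set (Fin 5)
  | .inl m => if m = j then (3, {1, 2}) else (2, {1, 3})
  | .inr _ => (3, {1, 2})

/-- The color scheme `τ_{j,k}` of a superedge. -/
def tau (j k : Fin 3) : Fin 3 ⊕ Fin 3 → Fin 5 × Set (Fin 5)
  | .inl m => if m = j then (3, {1, 2}) else (1, {2, 3})
  | .inr m => if m = k then (3, {1, 2}) else (2, {1, 3})

/-- `c` is a right coloring `R_j((2,1),3)`: a normal 5-edge-coloring consistent with `κ_j` with a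
Kempe `(2,1)`-chain connecting the two left semiedges other than the `j`-th one. -/
def IsRightColoring (j : Fin 3) (c : MultipoleColoring B.Inner (Fin 3 ⊕ Fin 3)) : Prop :=
  B.multipole.IsNormal c ∧
  (∀ s, Consistent (B.multipole.scheme c s) (kappa j s)) ∧
  ∀ m n, m ≠ j → n ≠ j → m ≠ n → B.multipole.IsKempeChainEnds c 2 1 (.inl m) (.inl n)

/-- `c` is a left coloring `L_{j,k}((1,2),3,(2,1))`: a normal 5-edge-coloring consistent with
`τ_{j,k}` with a Kempe `(1,2)`-chain connecting the two left semiedges other than the `j`-th one. -/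
def IsLeftColoring (j k : Fin 3) (c : MultipoleColoring B.Inner (Fin 3 ⊕ Fin 3)) : Prop :=
  B.multipole.IsNormal c ∧
  (∀ s, Consistent (B.multipole.scheme c s) (tau j k s)) ∧
  ∀ m n, m ≠ j → n ≠ j → m ≠ n → B.multipole.IsKempeChainEnds c 1 2 (.inl m) (.inl n)

/-- The superedge has a `j`-right coloring for at least two distinct values of `j`. -/
def IsDoublyRight : Prop :=
  ∃ j j' : Fin 3, j ≠ j' ∧ (∃ c, B.IsRightColoring j c) ∧ ∃ c, B.IsRightColoring j' c

/-- For every `j`, the superedge has a `j,k`-left coloring for at least two distinct values of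
`k`. -/
def IsDoublyLeft : Prop :=
  ∀ j : Fin 3, ∃ k k' : Fin 3, k ≠ k' ∧
    (∃ c, B.IsLeftColoring j k c) ∧ ∃ c, B.IsLeftColoring j k' c

end Superedge

/-! ### Superpositions of a graph along a cycle -/

/-- `u 0, u 1, …, u (g - 1)`, with indices modulo `g`, are the consecutive vertices of a cycle of
length `g ≥ 3` in `G`. -/
structure IsCycleSeq {V : Type*} (G : SimpleGraph V) {g : ℕ} (u : ZMod g → V) : Prop where
  three_le : 3 ≤ g
  injective : Function.Injective u
  adj : ∀ i, G.Adj (u i) (u (i + 1))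

/-- The two kinds `A` and `A'` of supervertices. Both contain the vertex `u_i`. In `A` the other two
right semiedges of the preceding superedge are joined directly to the other two left semiedges of
the following one (through two isolated edges); in `A'` these two edges are subdivided by two
adjacent vertices. -/
inductive SupervertexKind
  | A
  | A'

/-- The data of a superposition `G_C(𝒜, ℬ)` along a cycle `C` of length `g`. -/
structure SuperpositionData (g : ℕ) (W : ZMod g → Type*) where
  /-- the supervertices `𝒜_i` replacing the vertices `u_i` -/
  supervertex : ZMod g → SupervertexKind
  /-- the superedges `ℬ_i` replacing the edges `e_i = u_i u_{i+1}` -/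
  superedge : ∀ i, Superedge (W i)
  /-- the semiedge permutations `p_i`: the right semiedge `k` of `ℬ_i` is connected to the left
  semiedge `p_i k` of `ℬ_{i+1}` -/
  perm : ZMod g → Equiv.Perm (Fin 3)
  /-- the dock indices `d_i`: the connection ending in the left semiedge `d_i` of `ℬ_i` passes
  through `u_i` -/
  dock : ZMod g → Fin 3

namespace SuperpositionData

variable {g : ℕ} {W : ZMod g → Type*}

/-- The vertices of the superposition: those of `G` (each vertex `u_i` of `C` being the vertex
`u_i` of `𝒜_i`), those of the superedges, and, for every `i` with `𝒜_i = A'`, two further vertices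
`u_i^j`, one for each non-dock index `j`. -/
inductive Vertex (V : Type*) (D : SuperpositionData g W)
  | base (v : V) : Vertex V D
  | inner (i : ZMod g) (w : (D.superedge i).Inner) : Vertex V D
  | prime (i : ZMod g) (j : Fin 3) (hA : D.supervertex i = .A') (hj : j ≠ D.dock i) : Vertex V D

/-- The edges of the superposition, each listed with at least one orientation. -/
inductive Edge {V : Type*} (G : SimpleGraph V) (u : ZMod g → V) (D : SuperpositionData g W) :
    Vertex V D → Vertex V D → Prop
  /-- the edges of `G` that are not edges of `C` -/
  | outer (v w : V) (h : G.Adj v w) (hC : ∀ i, s(v, w) ≠ s(u i, u (i + 1))) :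
      Edge G u D (.base v) (.base w)
  /-- the edges of the superedges -/
  | inner (i : ZMod g) (a b : (D.superedge i).Inner) (h : (D.superedge i).multipole.graph.Adj a b) :
      Edge G u D (.inner i a) (.inner i b)
  /-- the edge from `u_i` to the dock semiedge of `ℬ_i` -/
  | dockLeft (i : ZMod g) :
      Edge G u D (.base (u i)) (.inner i ((D.superedge i).leftVertex (D.dock i)))
  /-- the edge from `u_{i+1}` to the right semiedge of `ℬ_i` corresponding to the dock -/
  | dockRight (i : ZMod g) (k : Fin 3) (hk : D.perm i k = D.dock (i + 1)) :
      Edge G u D (.inner i ((D.superedge i).rightVertex k)) (.base (u (i + 1)))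
  /-- `𝒜_{i+1} = A`: non-dock right semiedges of `ℬ_i` are joined to left semiedges of `ℬ_{i+1}` -/
  | join (i : ZMod g) (k : Fin 3) (hA : D.supervertex (i + 1) = .A)
      (hk : D.perm i k ≠ D.dock (i + 1)) :
      Edge G u D (.inner i ((D.superedge i).rightVertex k))
        (.inner (i + 1) ((D.superedge (i + 1)).leftVertex (D.perm i k)))
  /-- `𝒜_i = A'`: the vertex `u_i^j` and the left semiedge `j` of `ℬ_i` -/
  | primeLeft (i : ZMod g) (j : Fin 3) (hA : D.supervertex i = .A') (hj : j ≠ D.dock i) :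
      Edge G u D (.prime i j hA hj) (.inner i ((D.superedge i).leftVertex j))
  /-- `𝒜_{i+1} = A'`: the right semiedge `k` of `ℬ_i` and the vertex `u_{i+1}^j`, `j = p_i k` -/
  | primeRight (i : ZMod g) (k : Fin 3) (hA : D.supervertex (i + 1) = .A')
      (hk : D.perm i k ≠ D.dock (i + 1)) :
      Edge G u D (.inner i ((D.superedge i).rightVertex k)) (.prime (i + 1) (D.perm i k) hA hk)
  /-- `𝒜_i = A'`: the edge joining the two vertices `u_i^j` and `u_i^{j'}` -/
  | primePrime (i : ZMod g) (j j' : Fin 3) (hA : D.supervertex i = .A') (hj : j ≠ D.dock i)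
      (hj' : j' ≠ D.dock i) (hjj : j ≠ j') :
      Edge G u D (.prime i j hA hj) (.prime i j' hA hj')

/-- The superposition of `G` along the cycle with vertices `u 0, …, u (g - 1)`. -/
def graph {V : Type*} (D : SuperpositionData g W) (G : SimpleGraph V) (u : ZMod g → V) :
    SimpleGraph (Vertex V D) :=
  SimpleGraph.fromRel (Edge G u D)

end SuperpositionData

end SnarkSuperposition

namespace SnarkSuperposition

/-! ### Triples of colors -/

/-! Write T_i for the triple of colors of `σ` at u_i and a_i for the color of u_i u_{i+1}. Normality
of `σ` says that T_{i+1} is T_i or {a_i} together with the complement of T_i. The coloring `σ` is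
kept outside C, and each ℬ_i is colored so that its left semiedges fit T_i and its right semiedges
fit T_{i+1}: the triple at the end-vertex is the given triple T, or the semiedge color together with
the complement of T. Two triples that fit the same T at the same color have a union of size 3 or 5,
so every connecting edge is automatically normal. What remains is to match colors at each
supervertex (`IsCompatible`).

A right coloring, after a permutation of colors, has a_i on one left semiedge, any other b in T_i on
the remaining two, and a_i on all right semiedges. A left coloring has a_i on one left and one right
semiedge, b on the other left ones and a_{i+1} on the other right ones. Here T_i and T_{i+1} may
differ, so a single permutation need not serve both sides. The Kempe chain repairs this: all its
vertices see the colors 1, 2, 3 and every edge leaving it has color 3, so the chain can be recolored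
by any permutation that fixes 3 and sends {1, 2} to {1, 2} or {4, 5} (`IsNormal.recolor_kempe`).

If every ℬ_i has a right coloring at its dock index, these colorings match, with both edges of u_i
toward the superedges keeping their colors from C. Otherwise some ℬ_{i₀} fails at its dock, hence
has right colorings at both other indices. All other superedges get left colorings, chosen one after
another from i₀ + 1 so that the two edges at each u_{i+1} with i ≠ i₀ exchange their colors.
Double-leftness gives the freedom to keep the exceptional right semiedge off the dock. On returning
to i₀ the exceptional left index is not the dock, and the right coloring available there closes the
cycle. -/

theorem ncard_union_of_fits {T S S' : Set (Fin 5)} {a : Fin 5} (hT : T.ncard = 3) (ha : a ∈ T)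
    (hS : S = T ∨ S = insert a Tᶜ) (hS' : S' = T ∨ S' = insert a Tᶜ) :
    (S ∪ S').ncard = 3 ∨ (S ∪ S').ncard = 5 := by
  have hc : (insert a Tᶜ).ncard = 3 := by
    rw [Set.ncard_insert_of_notMem (by simpa using ha), Set.ncard_compl, hT]; simp
  have hu : T ∪ insert a Tᶜ = univ := by
    simp
  have h5 : (univ : Set (Fin 5)).ncard = 5 := by simp [Set.ncard_univ]
  rcases hS with rfl | rfl <;> rcases hS' with rfl | rfl
  · simp [hT]
  · rw [hu]; simp [h5]
  · rw [union_comm, hu]; simp [h5]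
  · rw [union_self]; simp [hc]

/-- A union of size 3 forces the triples to coincide. A union of size 5 leaves only `a` in common,
since the sizes add up to 6. -/
theorem eq_or_eq_insert_compl {T S : Set (Fin 5)} {a : Fin 5} (hT : T.ncard = 3)
    (hS : S.ncard = 3) (ha : a ∈ T) (ha' : a ∈ S)
    (h : (T ∪ S).ncard = 3 ∨ (T ∪ S).ncard = 5) : S = T ∨ S = insert a Tᶜ := by
  rcases h with h | h
  · left
    have h1 : T = T ∪ S := Set.eq_of_subset_of_ncard_le subset_union_left (by omega)
    have h2 : S = T ∪ S := Set.eq_of_subset_of_ncard_le subset_union_right (by omega)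
    rw [h2, ← h1]
  · right
    have hu : T ∪ S = univ :=
      Set.eq_of_subset_of_ncard_le (subset_univ _) (by simp [Set.ncard_univ, h])
    have hc : (insert a Tᶜ).ncard = 3 := by
      rw [Set.ncard_insert_of_notMem (by simpa using ha), Set.ncard_compl, hT]; simp
    refine (Set.eq_of_subset_of_ncard_le ?_ (by omega)).symm
    rintro x (rfl | hx)
    · exact ha'
    · exact (hu ▸ mem_univ x : x ∈ T ∪ S).resolve_left hx

theorem eq_insert_compl_symm {T S : Set (Fin 5)} {a : Fin 5} (ha : a ∈ T)
    (h : S = T ∨ S = insert a Tᶜ) : T = S ∨ T = insert a Sᶜ := by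
  rcases h with rfl | rfl
  · exact .inl rfl
  · right
    ext x
    by_cases hx : x = a
    · simp [hx, ha]
    · simp [hx]

/-! ### Semiedges fitting a triple -/

namespace Multipole

variable {V S : Type*} {M : Multipole V S}

/-- The semiedge `s` has color `a`, and its color scheme is consistent with `(a, T \ {a})`. -/
def Fits (M : Multipole V S) (c : MultipoleColoring V S) (s : S) (a : Fin 5)
    (T : Set (Fin 5)) : Prop :=
  c.semi s = a ∧ (M.colorsAt c (M.base s) = T ∨ M.colorsAt c (M.base s) = insert a Tᶜ)

theorem semi_mem_colorsAt (c : MultipoleColoring V S) (s : S) :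
    c.semi s ∈ M.colorsAt c (M.base s) := .inr ⟨s, rfl, rfl⟩

theorem Fits.of_consistent {c : MultipoleColoring V S} {s : S} {a : Fin 5} {p : Set (Fin 5)}
    (h : Consistent (M.scheme c s) (a, p)) : M.Fits c s a (insert a p) := by
  obtain ⟨h1, h2⟩ := h
  have h1 : c.semi s = a := h1
  have hm := M.semi_mem_colorsAt c s
  have h3 : M.colorsAt c (M.base s) = insert a (M.scheme c s).2 := by
    simp only [scheme]
    rw [← h1]; simp [Set.insert_eq_of_mem hm]
  refine ⟨h1, ?_⟩
  rcases h2 with h2 | h2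
  · left; rw [h3, h2]
  · right; rw [h3, h2]; rfl

/-- For `a ∈ T`, passing from `T` to `insert a Tᶜ` is an involution, so both triples describe the
same consistency class at color `a`. -/
theorem Fits.switch {c : MultipoleColoring V S} {s : S} {a : Fin 5} {T T' : Set (Fin 5)}
    (h : M.Fits c s a T) (ha : a ∈ T) (hT : T' = T ∨ T' = insert a Tᶜ) : M.Fits c s a T' := by
  refine ⟨h.1, ?_⟩
  rcases hT with rfl | rfl
  · exact h.2
  · rcases h.2 with h2 | h2
    · right; rw [h2]
      ext x
      by_cases hx : x = a
      · simp [hx, ha]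
      · simp [hx]
    · left; exact h2

end Multipole

/-! ### Permutations of colors, global and local -/

namespace MultipoleColoring

variable {V S : Type*}

/-- The coloring with permuted colors. -/
def permute (π : Equiv.Perm (Fin 5)) (c : MultipoleColoring V S) : MultipoleColoring V S where
  edge e := π (c.edge e)
  semi s := π (c.semi s)

end MultipoleColoring

namespace Multipole

variable {V S : Type*} {M : Multipole V S}

theorem colorsAt_permute (π : Equiv.Perm (Fin 5)) (c : MultipoleColoring V S) (v : V) :
    M.colorsAt (c.permute π) v = π '' M.colorsAt c v := by
  ext k
  simp only [colorsAt, MultipoleColoring.permute, mem_ofPred_eq, mem_image]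
  constructor
  · rintro (⟨w, hw, rfl⟩ | ⟨s, hs, rfl⟩)
    · exact ⟨_, .inl ⟨w, hw, rfl⟩, rfl⟩
    · exact ⟨_, .inr ⟨s, hs, rfl⟩, rfl⟩
  · rintro ⟨_, ⟨w, hw, rfl⟩ | ⟨s, hs, rfl⟩, rfl⟩
    · exact .inl ⟨w, hw, rfl⟩
    · exact .inr ⟨s, hs, rfl⟩

theorem IsNormal.permute {c : MultipoleColoring V S} (h : M.IsNormal c)
    (π : Equiv.Perm (Fin 5)) : M.IsNormal (c.permute π) := by
  obtain ⟨⟨h1, h2, h3⟩, h4⟩ := h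
  refine ⟨⟨fun v a b ha hb hab e => h1 v a b ha hb hab (π.injective e),
    fun s t hst hb e => h2 s t hst hb (π.injective e),
    fun s w hw e => h3 s w hw (π.injective e)⟩, fun v w hvw => ?_⟩
  rw [colorsAt_permute, colorsAt_permute, ← image_union,
    Set.ncard_image_of_injective _ π.injective]
  exact h4 v w hvw

theorem Fits.permute {c : MultipoleColoring V S} {s : S} {a : Fin 5} {T : Set (Fin 5)}
    (h : M.Fits c s a T) (π : Equiv.Perm (Fin 5)) :
    M.Fits (c.permute π) s (π a) (π '' T) := by
  refine ⟨congrArg π h.1, ?_⟩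
  rw [colorsAt_permute]
  rcases h.2 with h2 | h2
  · left; rw [h2]
  · right; rw [h2, image_insert_eq, image_compl_eq π.bijective]

/-- A recoloring that permutes the colors at each vertex preserves properness. -/
theorem isProper_of_local {c c' : MultipoleColoring V S} (h : M.IsProper c)
    (hloc : ∀ v, ∃ ρ : Equiv.Perm (Fin 5),
      (∀ w, M.graph.Adj v w → c'.edge s(v, w) = ρ (c.edge s(v, w))) ∧
      ∀ s, M.base s = v → c'.semi s = ρ (c.semi s)) : M.IsProper c' := by
  obtain ⟨h1, h2, h3⟩ := h
  refine ⟨fun v a b ha hb hab => ?_, fun s t hst hb => ?_, fun s w hw => ?_⟩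
  · obtain ⟨ρ, hρ, -⟩ := hloc v
    rw [hρ a ha, hρ b hb]
    exact fun e => h1 v a b ha hb hab (ρ.injective e)
  · obtain ⟨ρ, -, hρ⟩ := hloc (M.base s)
    rw [hρ s rfl, hρ t hb.symm]
    exact fun e => h2 s t hst hb (ρ.injective e)
  · obtain ⟨ρ, hρ, hρ'⟩ := hloc (M.base s)
    rw [hρ w hw, hρ' s rfl]
    exact fun e => h3 s w hw (ρ.injective e)

theorem colorsAt_of_local {c c' : MultipoleColoring V S} {v : V} {ρ : Equiv.Perm (Fin 5)}
    (he : ∀ w, M.graph.Adj v w → c'.edge s(v, w) = ρ (c.edge s(v, w)))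
    (hs : ∀ s, M.base s = v → c'.semi s = ρ (c.semi s)) :
    M.colorsAt c' v = ρ '' M.colorsAt c v := by
  rw [← colorsAt_permute]
  ext k
  simp only [colorsAt, MultipoleColoring.permute, mem_ofPred_eq]
  constructor
  · rintro (⟨w, hw, rfl⟩ | ⟨s, h, rfl⟩)
    · exact .inl ⟨w, hw, (he w hw).symm⟩
    · exact .inr ⟨s, h, (hs s h).symm⟩
  · rintro (⟨w, hw, rfl⟩ | ⟨s, h, rfl⟩)
    · exact .inl ⟨w, hw, he w hw⟩
    · exact .inr ⟨s, h, hs s h⟩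

/-! ### Kempe chains and their recoloring -/

/-- Along a nontrivial Kempe chain both colors occur at every vertex, on the chain itself. -/
theorem exists_kempe_colors {c : MultipoleColoring V S} (h : M.IsProper c) {a b : Fin 5}
    {s t : S} (hst : M.base s ≠ M.base t) (hs : c.semi s = a) (ht : c.semi t = a)
    (P : M.graph.Walk (M.base s) (M.base t)) (hP : P.IsPath)
    (hcol : ∀ e ∈ P.edges, c.edge e = a ∨ c.edge e = b) {v : V} (hv : v ∈ P.support)
    {k : Fin 5} (hk : k = a ∨ k = b) :
    (∃ w, M.graph.Adj v w ∧ s(v, w) ∈ P.edges ∧ c.edge s(v, w) = k) ∨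
      ∃ r, (r = s ∨ r = t) ∧ M.base r = v ∧ c.semi r = k := by
  obtain ⟨h1, h2, h3⟩ := h
  have hadj : ∀ n < P.length, M.graph.Adj (P.getVert n) (P.getVert (n + 1)) ∧
      s(P.getVert n, P.getVert (n + 1)) ∈ P.edges := fun n hn =>
    ⟨P.adj_getVert_succ hn,
      P.mem_edges_toSubgraph.1 (P.toSubgraph_adj_getVert hn)⟩
  have hlen : 0 < P.length := by
    rcases Nat.eq_zero_or_pos P.length with h0 | h0
    · exact absurd (SimpleGraph.Walk.eq_of_length_eq_zero h0) hst
    · exact h0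
  obtain ⟨n, rfl, hn⟩ := SimpleGraph.Walk.mem_support_iff_exists_getVert.1 hv
  rcases Nat.eq_zero_or_pos n with rfl | hn0
  · rw [P.getVert_zero] at *
    obtain ⟨ha, he⟩ := hadj 0 hlen
    rw [P.getVert_zero] at ha he
    have hne := h3 s _ ha
    rcases hk with rfl | rfl
    · exact .inr ⟨s, .inl rfl, rfl, hs⟩
    · exact .inl ⟨_, ha, he, (hcol _ he).resolve_left fun e => hne (hs.trans e.symm)⟩
  · rcases hn.eq_or_lt with rfl | hn1
    · rw [P.getVert_length] at *
      obtain ⟨ha, he⟩ := hadj (P.length - 1) (by omega)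
      rw [Nat.sub_add_cancel hlen, P.getVert_length, Sym2.eq_swap] at he
      rw [Nat.sub_add_cancel hlen, P.getVert_length] at ha
      have hne := h3 t _ ha.symm
      rcases hk with rfl | rfl
      · exact .inr ⟨t, .inr rfl, rfl, ht⟩
      · exact .inl ⟨_, ha.symm, he, (hcol _ he).resolve_left fun e => hne (ht.trans e.symm)⟩
    · left
      obtain ⟨ha, he⟩ := hadj n hn1
      obtain ⟨ha', he'⟩ := hadj (n - 1) (by omega)
      rw [Nat.sub_add_cancel hn0] at ha' he'
      rw [Sym2.eq_swap] at he'
      -- On a path the predecessor and the successor are distinct, so by properness the two chain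
      -- edges at an interior vertex carry both colors.
      have hne : P.getVert (n + 1) ≠ P.getVert (n - 1) := fun e => by
        have := hP.getVert_injOn (by simp; omega) (by simp; omega) e
        omega
      have hc := h1 _ _ _ ha ha'.symm hne
      have e1 := hcol _ he
      have e2 := hcol _ he'
      rcases hk with rfl | rfl
      · rcases e1 with e1 | e1
        · exact ⟨_, ha, he, e1⟩
        · exact ⟨_, ha'.symm, he', e2.resolve_right fun e => hc (e1.trans e.symm)⟩
      · rcases e1 with e1 | e1
        · exact ⟨_, ha'.symm, he', e2.resolve_left fun e => hc (e1.trans e.symm)⟩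
        · exact ⟨_, ha, he, e1⟩

end Multipole
theorem ncard_one_two_three : ({1, 2, 3} : Set (Fin 5)).ncard = 3 := by
  rw [← Finset.coe_singleton, ← Finset.coe_insert, ← Finset.coe_insert, Set.ncard_coe_finset]
  rfl

namespace Multipole

variable {V S : Type*} {M : Multipole V S}

/-- Induction along the chain: each vertex sees both 1 and 2, and a neighbour of a vertex with
triple {1, 2, 3} that shares the color 1 has either the same triple or {1, 4, 5}. The latter lacks
2. -/
theorem IsNormal.kempe_colorsAt {c : MultipoleColoring V S} (hc : M.IsNormal c)
    (hcard : ∀ v, (M.colorsAt c v).ncard = 3) {s t : S} (hst : M.base s ≠ M.base t)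
    (hs : M.Fits c s 1 {1, 2, 3}) (ht : c.semi t = 1)
    (P : M.graph.Walk (M.base s) (M.base t)) (hP : P.IsPath)
    (hcol : ∀ e ∈ P.edges, c.edge e = 1 ∨ c.edge e = 2) {v : V} (hv : v ∈ P.support) :
    M.colorsAt c v = {1, 2, 3} := by
  have hmem : ∀ v ∈ P.support, ∀ k, (k = 1 ∨ k = 2) → k ∈ M.colorsAt c v := by
    intro v hv k hk
    rcases exists_kempe_colors hc.1 hst hs.1 ht P hP hcol hv hk with ⟨w, hw, -, he⟩ | ⟨r, -, hr, he⟩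
    · exact .inl ⟨w, hw, he⟩
    · exact .inr ⟨r, hr, he⟩
  have key : ∀ n ≤ P.length, M.colorsAt c (P.getVert n) = {1, 2, 3} := by
    intro n
    induction n with
    | zero =>
      intro _
      rw [P.getVert_zero]
      rcases hs.2 with h | h
      · exact h
      · have := hmem _ P.start_mem_support 2 (.inr rfl)
        rw [h] at this
        revert this; simp
    | succ n ih =>
      intro hn
      have h0 := ih (by omega)
      have ha := P.adj_getVert_succ (i := n) (by omega)
      have hv := P.getVert_mem_support (n + 1)
      have m1 := hmem _ hv 1 (.inl rfl)
      have m2 := hmem _ hv 2 (.inr rfl)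
      have hd := hc.2 _ _ ha
      rw [h0] at hd
      rcases eq_or_eq_insert_compl ncard_one_two_three (hcard _) (by simp) m1 hd with h | h
      · exact h
      · rw [h] at m2
        revert m2; simp
  obtain ⟨n, rfl, hn⟩ := SimpleGraph.Walk.mem_support_iff_exists_getVert.1 hv
  exact key n hn

/-- Recoloring a Kempe `(1, 2)`-chain whose ends fit `{1, 2, 3}` by a permutation of the colors
that fixes `3` and respects the pairs `{1, 2}` and `{4, 5}`. -/
theorem IsNormal.recolor_kempe {c : MultipoleColoring V S} (hc : M.IsNormal c)
    (hcard : ∀ v, (M.colorsAt c v).ncard = 3) {s t : S} (hst : M.base s ≠ M.base t)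
    (hs : M.Fits c s 1 {1, 2, 3}) (ht : c.semi t = 1)
    (P : M.graph.Walk (M.base s) (M.base t)) (hP : P.IsPath)
    (hcol : ∀ e ∈ P.edges, c.edge e = 1 ∨ c.edge e = 2)
    (ρ : Equiv.Perm (Fin 5)) (hρ3 : ρ 3 = 3)
    (hρ : ρ '' {1, 2, 3} = {1, 2, 3} ∨ ρ '' {1, 2, 3} = insert 3 {1, 2, 3}ᶜ) :
    ∃ c' : MultipoleColoring V S, M.IsNormal c' ∧
      M.Fits c' s (ρ 1) (ρ '' {1, 2, 3}) ∧ M.Fits c' t (ρ 1) (ρ '' {1, 2, 3}) ∧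
      ∀ r, r ≠ s → r ≠ t → ∀ a, M.Fits c r a {1, 2, 3} → M.Fits c' r a {1, 2, 3} := by
  classical
  have hZ := fun v (hv : v ∈ P.support) =>
    hc.kempe_colorsAt hcard hst hs ht P hP hcol hv
  have hex := fun v (hv : v ∈ P.support) k hk =>
    exists_kempe_colors hc.1 hst hs.1 ht P hP hcol hv (k := k) hk
  let c' : MultipoleColoring V S :=
    { edge := fun e => if e ∈ P.edges then ρ (c.edge e) else c.edge e
      semi := fun r => if r = s ∨ r = t then ρ (c.semi r) else c.semi r }
  -- At a chain vertex the colors 1 and 2 are used by the chain itself, so whatever leaves the chain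
  -- has the third color, 3.
  have hedge : ∀ v ∈ P.support, ∀ w, M.graph.Adj v w → s(v, w) ∉ P.edges →
      c.edge s(v, w) = 3 := by
    intro v hv w hw he
    have hm : c.edge s(v, w) ∈ M.colorsAt c v := .inl ⟨w, hw, rfl⟩
    rw [hZ v hv] at hm
    by_contra h3
    have hk : c.edge s(v, w) = 1 ∨ c.edge s(v, w) = 2 := by
      simp only [mem_insert_iff, mem_singleton_iff] at hm; tauto
    rcases hex v hv _ hk with ⟨w', hw', he', h⟩ | ⟨r, -, rfl, h⟩
    · have : w' ≠ w := by rintro rfl; exact he he'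
      exact hc.1.1 v w' w hw' hw this h
    · exact hc.1.2.2 r w hw h
  have hsemi : ∀ r, M.base r ∈ P.support → ¬ (r = s ∨ r = t) → c.semi r = 3 := by
    intro r hv he
    have hm : c.semi r ∈ M.colorsAt c (M.base r) := .inr ⟨r, rfl, rfl⟩
    rw [hZ _ hv] at hm
    by_contra h3
    have hk : c.semi r = 1 ∨ c.semi r = 2 := by
      simp only [mem_insert_iff, mem_singleton_iff] at hm; tauto
    rcases hex _ hv _ hk with ⟨w', hw', -, h⟩ | ⟨r', hr', hb, h⟩
    · exact hc.1.2.2 r w' hw' h.symm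
    · have : r' ≠ r := by rintro rfl; exact he hr'
      exact hc.1.2.1 r' r this hb h
  -- Since `ρ` fixes 3, the recoloring acts at a chain vertex as `ρ` on all three incident colors,
  -- including those it does not touch.
  have hin : ∀ v ∈ P.support,
      (∀ w, M.graph.Adj v w → c'.edge s(v, w) = ρ (c.edge s(v, w))) ∧
      ∀ r, M.base r = v → c'.semi r = ρ (c.semi r) := by
    intro v hv
    constructor
    · intro w hw
      by_cases he : s(v, w) ∈ P.edges
      · simp [c', he]
      · have h3 := hedge v hv w hw he
        simp [c', he, h3, hρ3]
    · intro r hr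
      by_cases he : r = s ∨ r = t
      · simp [c', he]
      · have h3 := hsemi r (hr ▸ hv) he
        simp [c', he, h3, hρ3]
  have hout : ∀ v ∉ P.support,
      (∀ w, M.graph.Adj v w → c'.edge s(v, w) = (1 : Equiv.Perm (Fin 5)) (c.edge s(v, w))) ∧
      ∀ r, M.base r = v → c'.semi r = (1 : Equiv.Perm (Fin 5)) (c.semi r) := by
    intro v hv
    constructor
    · intro w hw
      have : s(v, w) ∉ P.edges := fun h => hv (P.fst_mem_support_of_mem_edges h)
      simp [c', this]
    · rintro r rfl
      have : ¬ (r = s ∨ r = t) := by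
        rintro (rfl | rfl)
        · exact hv P.start_mem_support
        · exact hv P.end_mem_support
      simp [c', this]
  have hZ' : ∀ v ∈ P.support, M.colorsAt c' v = ρ '' {1, 2, 3} := fun v hv => by
    rw [colorsAt_of_local (hin v hv).1 (hin v hv).2, hZ v hv]
  have hO' : ∀ v ∉ P.support, M.colorsAt c' v = M.colorsAt c v := fun v hv => by
    rw [colorsAt_of_local (hout v hv).1 (hout v hv).2]; simp
  -- An edge leaving the chain has color 3. At this color both the triple outside the chain and the
  -- `ρ`-image of {1, 2, 3} fit {1, 2, 3}, so the edge stays normal.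
  have hcross : ∀ v ∈ P.support, ∀ w ∉ P.support,  M.graph.Adj v w →
      (M.colorsAt c' v ∪ M.colorsAt c' w).ncard = 3 ∨
        (M.colorsAt c' v ∪ M.colorsAt c' w).ncard = 5 := by
    intro v hv w hw hvw
    rw [hZ' v hv, hO' w hw]
    have hn := hc.2 v w hvw
    rw [hZ v hv] at hn
    have hm3 : c.edge s(v, w) = 3 :=
      hedge v hv w hvw fun he => hw (P.snd_mem_support_of_mem_edges he)
    have hw3 : 3 ∈ M.colorsAt c w := .inl ⟨v, hvw.symm, by rw [Sym2.eq_swap, hm3]⟩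
    exact ncard_union_of_fits ncard_one_two_three (by simp : (3 : Fin 5) ∈ _) hρ
      (eq_or_eq_insert_compl ncard_one_two_three (hcard w) (by simp) hw3 hn)
  refine ⟨c', ⟨isProper_of_local hc.1 fun v => ?_, fun v w hvw => ?_⟩, ?_, ?_, ?_⟩
  · by_cases hv : v ∈ P.support
    · exact ⟨ρ, hin v hv⟩
    · exact ⟨1, hout v hv⟩
  · by_cases hv : v ∈ P.support <;> by_cases hw : w ∈ P.support
    · rw [hZ' v hv, hZ' w hw]
      exact ncard_union_of_fits ncard_one_two_three (by simp : (3 : Fin 5) ∈ _) hρ hρ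
    · exact hcross v hv w hw hvw
    · rw [union_comm]; exact hcross w hw v hv hvw.symm
    · rw [hO' v hv, hO' w hw]; exact hc.2 v w hvw
  · exact ⟨by simp [c', hs.1], .inl (hZ' _ P.start_mem_support)⟩
  · exact ⟨by simp [c', ht], .inl (hZ' _ P.end_mem_support)⟩
  · intro r hrs hrt a hr
    refine ⟨by simpa [c', hrs, hrt] using hr.1, ?_⟩
    by_cases hv : M.base r ∈ P.support
    · have ha : a = 3 := hr.1.symm.trans (hsemi r hv (by tauto))
      rw [hZ' _ hv, ha]
      exact hρ
    · rw [hO' _ hv]; exact hr.2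

end Multipole
-- Normalizing permutations of the five colors
theorem exists_perm_of_pairwise_ne {a b b' d d' : Fin 5} (h : [a, b, b', d, d'].Nodup) :
    ∃ π : Equiv.Perm (Fin 5), π 1 = b' ∧ π 2 = b ∧ π 3 = a := by
  -- The positions are the colors 0, 1, 2, 3, 4, where 0 stands for color 5; `d` and `d'` fill the
  -- two unconstrained places.
  have hi : Function.Injective ![d, b', b, a, d'] := by
    simp only [List.nodup_cons, List.mem_cons, not_or] at h
    intro x y
    fin_cases x <;> fin_cases y <;> simp <;> tauto
  exact ⟨Equiv.ofBijective _ (Finite.injective_iff_bijective.1 hi), rfl, rfl, rfl⟩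

/-- A triple with two of its elements can be moved to `{1, 2, 3}`. -/
theorem exists_perm_image {T : Set (Fin 5)} (hT : T.ncard = 3) {a b : Fin 5} (ha : a ∈ T)
    (hb : b ∈ T) (hab : b ≠ a) :
    ∃ π : Equiv.Perm (Fin 5), π 2 = b ∧ π 3 = a ∧ π '' {1, 2, 3} = T := by
  obtain ⟨b', hb', hne⟩ : ∃ b' ∈ T, b' ∉ ({a, b} : Set (Fin 5)) := by
    by_contra! h
    have h1 := Set.ncard_le_ncard (show T ⊆ {a, b} from h)
    have h2 := Set.ncard_pair hab.symm
    omega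
  simp only [mem_insert_iff, mem_singleton_iff, not_or] at hne
  obtain ⟨d, d', hdd, hd⟩ := Set.ncard_eq_two.1 (show Tᶜ.ncard = 2 by
    rw [Set.ncard_compl, hT]; simp)
  have h1 : d ∉ T := by rw [← mem_compl_iff, hd]; simp
  have h2 : d' ∉ T := by rw [← mem_compl_iff, hd]; simp
  obtain ⟨π, h3, h4, h5⟩ := exists_perm_of_pairwise_ne (a := a) (b := b) (b' := b') (d := d)
    (d' := d') (by
      simp only [List.nodup_cons, List.mem_cons, not_or, List.not_mem_nil, not_false_eq_true,
        List.nodup_nil, and_true]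
      refine ⟨⟨hab.symm, Ne.symm hne.1, ?_, ?_⟩, ⟨Ne.symm hne.2, ?_, ?_⟩, ⟨?_, ?_⟩, hdd⟩ <;>
        rintro rfl <;> contradiction)
  refine ⟨π, h4, h5, Set.eq_of_subset_of_ncard_le ?_ ?_⟩
  · rw [image_insert_eq, image_pair, h3, h4, h5]
    rintro x (rfl | rfl | rfl) <;> assumption
  · rw [Set.ncard_image_of_injective _ π.injective, ncard_one_two_three, hT]

/-- If `x` is 1 or 2, the pair {1, 2} is preserved; if `x` is 4 or 5, it is exchanged with {4, 5}.
Both kinds of permutation are admissible on a Kempe chain. -/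
theorem exists_perm_of_ne_three {x : Fin 5} (hx : x ≠ 3) :
    ∃ ρ : Equiv.Perm (Fin 5), ρ 1 = x ∧ ρ 3 = 3 ∧
      (ρ '' {1, 2, 3} = {1, 2, 3} ∨ ρ '' {1, 2, 3} = insert 3 {1, 2, 3}ᶜ) := by
  have hc : (insert 3 {1, 2, 3}ᶜ : Set (Fin 5)) = {4, 0, 3} := by
    ext y; fin_cases y <;> simp
  rw [hc]
  obtain ⟨y, d, d', hy, h⟩ : ∃ y d d' : Fin 5, [3, y, x, d, d'].Nodup ∧
      (({x, y, 3} : Set (Fin 5)) = {1, 2, 3} ∨ ({x, y, 3} : Set (Fin 5)) = {4, 0, 3}) := by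
    have hx : x = 1 ∨ x = 2 ∨ x = 4 ∨ x = 0 := by revert x; decide
    rcases hx with rfl | rfl | rfl | rfl
    · exact ⟨2, 0, 4, by decide, .inl rfl⟩
    · exact ⟨1, 0, 4, by decide, .inl (insert_comm _ _ _)⟩
    · exact ⟨0, 1, 2, by decide, .inr rfl⟩
    · exact ⟨4, 1, 2, by decide, .inr (insert_comm _ _ _)⟩
  obtain ⟨ρ, h1, h2, h3⟩ := exists_perm_of_pairwise_ne hy
  refine ⟨ρ, h1, h3, ?_⟩
  rwa [image_insert_eq, image_pair, h1, h2, h3]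

/-! ### Colorings of a superedge with prescribed semiedge colors -/

namespace Superedge

variable {W : Type*} {B : Superedge W}

theorem leftVertex_injective : Function.Injective B.leftVertex := fun _ _ h =>
  B.left.injective (Subtype.ext (congrArg (fun w : B.Inner => w.1) h))

theorem rightVertex_injective : Function.Injective B.rightVertex := fun _ _ h =>
  B.right.injective (Subtype.ext (congrArg (fun w : B.Inner => w.1) h))

/-- Restoring `x` and `y` turns the edges and semiedges at an inner vertex into its three edges in
the cubic graph `H`, and properness makes their colors distinct. -/
theorem ncard_colorsAt {c : MultipoleColoring B.Inner (Fin 3 ⊕ Fin 3)}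
    (hc : B.multipole.IsProper c) (v : B.Inner) : (B.multipole.colorsAt c v).ncard = 3 := by
  classical
  -- The color of the edge of `H` from `v` to `w`, read off a semiedge when `w` is `x` or `y`. The
  -- value 0 off the neighbourhood is junk.
  let f : W → Fin 5 := fun w =>
    if hx : w = B.x then
      if h : (v : W) ∈ B.H.neighborSet B.x then c.semi (.inl (B.left.symm ⟨v, h⟩)) else 0
    else if hy : w = B.y then
      if h : (v : W) ∈ B.H.neighborSet B.y then c.semi (.inr (B.right.symm ⟨v, h⟩)) else 0
    else c.edge s(v, ⟨w, hx, hy⟩)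
  have hfx : ∀ j, v = B.leftVertex j → f B.x = c.semi (.inl j) := by
    rintro j rfl
    have h : ((B.leftVertex j : B.Inner) : W) ∈ B.H.neighborSet B.x := (B.left j).2
    have e : (⟨_, h⟩ : B.H.neighborSet B.x) = B.left j := rfl
    simp only [f, dif_pos h, e]; simp
  have hfy : ∀ j, v = B.rightVertex j → f B.y = c.semi (.inr j) := by
    rintro j rfl
    have h : ((B.rightVertex j : B.Inner) : W) ∈ B.H.neighborSet B.y := (B.right j).2
    have e : (⟨_, h⟩ : B.H.neighborSet B.y) = B.right j := rfl
    simp only [f, dif_pos h, e, dif_neg B.ne.symm]; simp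
  have hfi : ∀ w : B.Inner, f w = c.edge s(v, w) := fun w => by
    simp [f, w.2.1, w.2.2]
  have hl : B.H.Adj v B.x → ∃ j, v = B.leftVertex j := fun h =>
    ⟨B.left.symm ⟨v, h.symm⟩, Subtype.ext (by simp [leftVertex])⟩
  have hr : B.H.Adj v B.y → ∃ j, v = B.rightVertex j := fun h =>
    ⟨B.right.symm ⟨v, h.symm⟩, Subtype.ext (by simp [rightVertex])⟩
  obtain ⟨h1, h2, h3⟩ := hc
  have him : B.multipole.colorsAt c v = f '' B.H.neighborSet v := by
    ext k
    constructor
    · rintro (⟨w, hw, rfl⟩ | ⟨s | s, rfl, rfl⟩)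
      · exact ⟨w, hw, hfi w⟩
      · exact ⟨B.x, (B.left s).2.symm, hfx s rfl⟩
      · exact ⟨B.y, (B.right s).2.symm, hfy s rfl⟩
    · rintro ⟨w, hw, rfl⟩
      by_cases hx : w = B.x
      · subst hx
        obtain ⟨j, rfl⟩ := hl hw
        exact .inr ⟨.inl j, rfl, (hfx j rfl).symm⟩
      by_cases hy : w = B.y
      · subst hy
        obtain ⟨j, rfl⟩ := hr hw
        exact .inr ⟨.inr j, rfl, (hfy j rfl).symm⟩
      · exact .inl ⟨⟨w, hx, hy⟩, hw, (hfi ⟨w, hx, hy⟩).symm⟩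
  have hinj : InjOn f (B.H.neighborSet v) := by
    have key : ∀ a b, B.H.Adj v a → B.H.Adj v b → a ≠ b → a ≠ B.y → b ≠ B.x → f a ≠ f b := by
      intro a b ha hb hab hay hbx
      by_cases hax : a = B.x
      · subst hax
        obtain ⟨j, hj⟩ := hl ha
        rw [hfx j hj]
        by_cases hby : b = B.y
        · subst hby
          obtain ⟨k, hk⟩ := hr hb
          rw [hfy k hk]
          exact h2 _ _ (by simp) (hj.symm.trans hk)
        · subst hj
          have := h3 (.inl j) ⟨b, hbx, hby⟩ hb
          rwa [show f b = _ from hfi ⟨b, hbx, hby⟩]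
      · rw [show f a = _ from hfi ⟨a, hax, hay⟩]
        by_cases hby : b = B.y
        · subst hby
          obtain ⟨k, rfl⟩ := hr hb
          rw [hfy k rfl]
          exact (h3 (.inr k) ⟨a, hax, hay⟩ ha).symm
        · rw [show f b = _ from hfi ⟨b, hbx, hby⟩]
          exact h1 v ⟨a, hax, hay⟩ ⟨b, hbx, hby⟩ ha hb (by simpa using hab)
    intro a ha b hb hab
    by_contra hne
    -- Up to exchanging the two neighbours, the first is not `y` and the second is not `x`.
    by_cases h : a ≠ B.y ∧ b ≠ B.x
    · exact key a b ha hb hne h.1 h.2 hab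
    · refine key b a hb ha (Ne.symm hne) ?_ ?_ hab.symm
      · rintro rfl
        have : a = B.y ∨ B.y = B.x := by tauto
        rcases this with h | h
        · exact hne h
        · exact B.ne h.symm
      · rintro rfl
        have : B.x = B.y ∨ b = B.x := by tauto
        rcases this with h | h
        · exact B.ne h
        · exact hne h.symm
  rw [him, hinj.ncard_image]
  exact B.snark.cubic v

open Multipole in
/-- A right coloring with prescribed colors at the semiedges. -/
theorem IsRightColoring.exists_coloring {j : Fin 3}
    {c : MultipoleColoring B.Inner (Fin 3 ⊕ Fin 3)} (hc : B.IsRightColoring j c)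
    {T T' : Set (Fin 5)} (hT : T.ncard = 3) {a b : Fin 5} (ha : a ∈ T) (hb : b ∈ T) (hab : b ≠ a)
    (hTT : T' = T ∨ T' = insert a Tᶜ) :
    ∃ c', B.multipole.IsNormal c' ∧
      (∀ m, B.multipole.Fits c' (.inl m) (if m = j then a else b) T) ∧
      ∀ m, B.multipole.Fits c' (.inr m) a T' := by
  obtain ⟨hn, hs, -⟩ := hc
  obtain ⟨π, h2, h3, hπ⟩ := exists_perm_image hT ha hb hab
  have e3 : (insert 3 {1, 2} : Set (Fin 5)) = {1, 2, 3} := by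
    ext; simp; tauto
  have e2 : (insert 2 {1, 3} : Set (Fin 5)) = {1, 2, 3} := by
    ext; simp; tauto
  refine ⟨c.permute π, hn.permute π, fun m => ?_, fun m => ?_⟩
  · have h := hs (.inl m)
    by_cases hm : m = j
    · simp only [kappa, if_pos hm] at h ⊢
      simpa only [e3, hπ, h3] using (Fits.of_consistent h).permute π
    · simp only [kappa, if_neg hm] at h ⊢
      simpa only [e2, hπ, h2] using (Fits.of_consistent h).permute π
  · have h := (Fits.of_consistent (hs (.inr m))).permute π
    simp only [e3, hπ, h3] at h
    -- All right semiedges carry the shared color `a`, at which fitting `T` and fitting `T'` are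
    -- equivalent; this is why one permutation handles both sides.
    exact h.switch ha hTT

open Multipole in
/-- A left coloring with prescribed colors at the semiedges. -/
theorem IsLeftColoring.exists_coloring {j k : Fin 3}
    {c : MultipoleColoring B.Inner (Fin 3 ⊕ Fin 3)} (hc : B.IsLeftColoring j k c)
    {T T' : Set (Fin 5)} (hT : T.ncard = 3) (hT' : T'.ncard = 3) {a b b' : Fin 5} (ha : a ∈ T)
    (hb : b ∈ T) (hab : b ≠ a) (hb' : b' ∈ T') (hab' : b' ≠ a)
    (hTT : T' = T ∨ T' = insert a Tᶜ) :
    ∃ c', B.multipole.IsNormal c' ∧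
      (∀ m, B.multipole.Fits c' (.inl m) (if m = j then a else b) T) ∧
      ∀ m, B.multipole.Fits c' (.inr m) (if m = k then a else b') T' := by
  obtain ⟨hn, hs, hK⟩ := hc
  have ha' : a ∈ T' := by rcases hTT with rfl | rfl <;> simp [ha]
  have hTT' := eq_insert_compl_symm ha hTT
  -- The permutation is adjusted to the right side. The left semiedge `j` then fits `T` as well
  -- because it has color `a`; the other two left semiedges need the recoloring.
  obtain ⟨π, h2, h3, hπ⟩ := exists_perm_image hT' ha' hb' hab'
  have e3 : (insert 3 {1, 2} : Set (Fin 5)) = {1, 2, 3} := by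
    ext; simp; tauto
  have e2 : (insert 2 {1, 3} : Set (Fin 5)) = {1, 2, 3} := by
    ext; simp; tauto
  have fl : ∀ m, m ≠ j → B.multipole.Fits c (.inl m) 1 {1, 2, 3} := fun m hm => by
    have h := hs (.inl m)
    simp only [tau, if_neg hm] at h
    exact Fits.of_consistent h
  have flj : B.multipole.Fits c (.inl j) 3 {1, 2, 3} := by
    have h := hs (.inl j)
    simp only [tau, if_true] at h
    exact e3 ▸ Fits.of_consistent h
  have fr : ∀ m, B.multipole.Fits c (.inr m) (if m = k then 3 else 2) {1, 2, 3} := fun m => by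
    have h := hs (.inr m)
    by_cases hm : m = k
    · simp only [tau, if_pos hm] at h ⊢
      exact e3 ▸ Fits.of_consistent h
    · simp only [tau, if_neg hm] at h ⊢
      exact e2 ▸ Fits.of_consistent h
  obtain ⟨m, n, hm, hn', hmn, hall⟩ : ∃ m n : Fin 3, m ≠ j ∧ n ≠ j ∧ m ≠ n ∧
      ∀ i, i = j ∨ i = m ∨ i = n := by
    clear * -; revert j; decide
  obtain ⟨-, -, -, P, hP, hcol⟩ := hK m n hm hn' hmn
  -- The chain is recolored before `π` is applied, so its end color 1 must first become `π.symm b`.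
  obtain ⟨ρ, hρ1, hρ3, hρ⟩ := exists_perm_of_ne_three (x := π.symm b) (by
    rw [Ne, Equiv.symm_apply_eq, h3]; exact hab)
  obtain ⟨c', hc', hl, hl', hr⟩ := hn.recolor_kempe (ncard_colorsAt hn.1)
    (s := .inl m) (t := .inl n) (fun h => hmn (leftVertex_injective h)) (fl m hm) (fl n hn').1
    P hP hcol ρ hρ3 hρ
  -- The triple at the recolored ends is `T'` or its switch at `a`, and so is `T`. These two
  -- candidates meet only in `a`, and both sets contain `b ≠ a`, so they agree.
  have hT3 : π '' (ρ '' {1, 2, 3}) = T := by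
    have hbm : b ∈ π '' (ρ '' {1, 2, 3}) := ⟨π.symm b, ⟨1, by simp, hρ1⟩, by simp⟩
    have hX : π '' (ρ '' {1, 2, 3}) = T' ∨ π '' (ρ '' {1, 2, 3}) = insert a T'ᶜ := by
      rcases hρ with hρ | hρ
      · left; rw [hρ, hπ]
      · right; rw [hρ, image_insert_eq, image_compl_eq π.bijective, hπ, h3]
    rcases hX with hX | hX <;> rcases hTT' with h | h <;> rw [hX] at hbm ⊢
    · exact h.symm
    · rw [h] at hb
      exact absurd hbm (hb.resolve_left hab)
    · rw [h] at hb
      exact absurd hb (hbm.resolve_left hab)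
    · exact h.symm
  have hb1 : π (ρ 1) = b := by rw [hρ1]; simp
  refine ⟨c'.permute π, hc'.permute π, fun i => ?_, fun i => ?_⟩
  · rcases hall i with rfl | rfl | rfl
    · have h := (hr (.inl i) (by simpa using hm.symm) (by simpa using hn'.symm) 3 flj).permute π
      rw [h3, hπ] at h
      rw [if_pos rfl]
      exact h.switch ha' hTT'
    · have h := hl.permute π
      rw [hT3, hb1] at h
      rwa [if_neg hm]
    · have h := hl'.permute π
      rw [hT3, hb1] at h
      rwa [if_neg hn']
  · have h := (hr (.inr i) (by simp) (by simp) _ (fr i)).permute π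
    rwa [hπ, apply_ite π, h2, h3] at h

end Superedge
-- Edge colorings given by a relation
/-- A normal coloring from a symmetric relation `K x y k`, read as `xy` has color `k`. -/
theorem exists_isNormalColoring {X : Type*} {Γ : SimpleGraph X} (K : X → X → Fin 5 → Prop)
    (S : X → Set (Fin 5)) (hsymm : ∀ x y k, K x y k → K y x k)
    (hadj : ∀ x y, Γ.Adj x y ↔ ∃ k, K x y k)
    (huniq : ∀ x y y' k k', K x y k → K x y' k' → (y = y' ↔ k = k'))
    (hS : ∀ x k, k ∈ S x ↔ ∃ y, K x y k)
    (hnormal : ∀ x y k, K x y k → (S x ∪ S y).ncard = 3 ∨ (S x ∪ S y).ncard = 5) :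
    ∃ τ : Sym2 X → Fin 5, IsNormalColoring Γ τ := by
  let τ : Sym2 X → Fin 5 := Sym2.lift ⟨fun x y => Classical.epsilon (K x y), fun x y =>
    congrArg _ (funext fun k => propext ⟨hsymm x y k, hsymm y x k⟩)⟩
  have hτ : ∀ x y, Γ.Adj x y → K x y (τ s(x, y)) := fun x y h =>
    Classical.epsilon_spec ((hadj x y).1 h)
  have hcol : ∀ x, colorsAt Γ τ x = S x := by
    intro x
    ext k
    rw [hS]
    constructor
    · rintro ⟨y, hy, rfl⟩
      exact ⟨y, hτ x y hy⟩
    · rintro ⟨y, hy⟩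
      have ha := (hadj x y).2 ⟨k, hy⟩
      exact ⟨y, ha, (huniq _ _ _ _ _ (hτ x y ha) hy).1 rfl⟩
  refine ⟨τ, fun v a b ha hb hab e => hab ((huniq _ _ _ _ _ (hτ v a ha) (hτ v b hb)).2 e),
    fun v w hvw => ?_⟩
  rw [IsNormalEdge, hcol, hcol]
  exact hnormal v w _ (hτ v w hvw)

theorem IsCubic.ncard_colorsAt {V κ : Type*} {G : SimpleGraph V} (hG : IsCubic G)
    {σ : Sym2 V → κ} (hσ : IsProperEdgeColoring G σ) (v : V) : (colorsAt G σ v).ncard = 3 := by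
  have h : colorsAt G σ v = (fun w => σ s(v, w)) '' G.neighborSet v := rfl
  rw [h, Set.InjOn.ncard_image, hG v]
  intro a ha b hb hab
  by_contra hne
  exact hσ v a b ha hb hne hab

/-! ### Consequences of having length at least 3 -/

namespace IsCycleSeq

variable {V : Type*} {G : SimpleGraph V} {g : ℕ} {u : ZMod g → V}

theorem natCast_ne_zero (hC : IsCycleSeq G u) {n : ℕ} (h0 : 0 < n) (h : n < 3) :
    (n : ZMod g) ≠ 0 := by
  rw [Ne, ZMod.natCast_eq_zero_iff]
  intro hd
  have := Nat.le_of_dvd h0 hd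
  have := hC.three_le
  omega

theorem add_one_ne (hC : IsCycleSeq G u) (i : ZMod g) : i + 1 ≠ i := by
  have := hC.natCast_ne_zero (n := 1) (by omega) (by omega)
  simpa using this

theorem add_one_add_one_ne (hC : IsCycleSeq G u) (i : ZMod g) : i + 1 + 1 ≠ i := by
  have := hC.natCast_ne_zero (n := 2) (by omega) (by omega)
  rw [add_assoc, Ne, add_eq_left]
  push_cast at this
  rwa [one_add_one_eq_two]

theorem color_ne (hC : IsCycleSeq G u) {σ : Sym2 V → Fin 5}
    (hσ : IsProperEdgeColoring G σ) (i : ZMod g) :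
    σ s(u i, u (i + 1)) ≠ σ s(u (i + 1), u (i + 1 + 1)) := by
  rw [Sym2.eq_swap]
  exact hσ _ _ _ (hC.adj i).symm (hC.adj (i + 1)) fun h =>
    hC.add_one_add_one_ne i (hC.injective h).symm

end IsCycleSeq

/-! ### Colored edges of the superposition -/

namespace SuperpositionData

variable {V : Type*} {g : ℕ} {W : ZMod g → Type*}

/-- The edges of the superposition with their colors: those of `σ` outside `C`, those of `c i` in
`ℬ_i`, and `μ i` for the edge of `𝒜_i` inside a supervertex `A'`. -/
inductive ColoredEdge (G : SimpleGraph V) (σ : Sym2 V → Fin 5) (u : ZMod g → V)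
    (D : SuperpositionData g W)
    (c : ∀ i, MultipoleColoring (D.superedge i).Inner (Fin 3 ⊕ Fin 3)) (μ : ZMod g → Fin 5) :
    Vertex V D → Vertex V D → Fin 5 → Prop
  | outer (v w : V) (h : G.Adj v w) (hC : ∀ i, s(v, w) ≠ s(u i, u (i + 1))) :
      ColoredEdge G σ u D c μ (.base v) (.base w) (σ s(v, w))
  | inner (i : ZMod g) (a b : (D.superedge i).Inner) (h : (D.superedge i).multipole.graph.Adj a b) :
      ColoredEdge G σ u D c μ (.inner i a) (.inner i b) ((c i).edge s(a, b))
  | dockLeft (i : ZMod g) :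
      ColoredEdge G σ u D c μ (.base (u i)) (.inner i ((D.superedge i).leftVertex (D.dock i)))
        ((c i).semi (.inl (D.dock i)))
  | dockRight (i : ZMod g) (k : Fin 3) (hk : D.perm i k = D.dock (i + 1)) :
      ColoredEdge G σ u D c μ (.inner i ((D.superedge i).rightVertex k)) (.base (u (i + 1)))
        ((c i).semi (.inr k))
  | join (i : ZMod g) (k : Fin 3) (hA : D.supervertex (i + 1) = .A)
      (hk : D.perm i k ≠ D.dock (i + 1)) :
      ColoredEdge G σ u D c μ (.inner i ((D.superedge i).rightVertex k))
        (.inner (i + 1) ((D.superedge (i + 1)).leftVertex (D.perm i k))) ((c i).semi (.inr k))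
  | primeLeft (i : ZMod g) (j : Fin 3) (hA : D.supervertex i = .A') (hj : j ≠ D.dock i) :
      ColoredEdge G σ u D c μ (.prime i j hA hj) (.inner i ((D.superedge i).leftVertex j))
        ((c i).semi (.inl j))
  | primeRight (i : ZMod g) (k : Fin 3) (hA : D.supervertex (i + 1) = .A')
      (hk : D.perm i k ≠ D.dock (i + 1)) :
      ColoredEdge G σ u D c μ (.inner i ((D.superedge i).rightVertex k))
        (.prime (i + 1) (D.perm i k) hA hk) ((c i).semi (.inr k))
  | primePrime (i : ZMod g) (j j' : Fin 3) (hA : D.supervertex i = .A') (hj : j ≠ D.dock i)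
      (hj' : j' ≠ D.dock i) (hjj : j ≠ j') :
      ColoredEdge G σ u D c μ (.prime i j hA hj) (.prime i j' hA hj') (μ i)

/-- The end of the edge at a semiedge of `ℬ_i` that lies outside this semiedge's end-vertex. -/
inductive Mate (u : ZMod g → V) (D : SuperpositionData g W) :
    ZMod g → Fin 3 ⊕ Fin 3 → Vertex V D → Prop
  | dockLeft (i : ZMod g) : Mate u D i (.inl (D.dock i)) (.base (u i))
  | dockRight (i : ZMod g) (k : Fin 3) (hk : D.perm i k = D.dock (i + 1)) :
      Mate u D i (.inr k) (.base (u (i + 1)))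
  | joinRight (i : ZMod g) (k : Fin 3) (hk : D.perm i k ≠ D.dock (i + 1))
      (hA : D.supervertex (i + 1) = .A) :
      Mate u D i (.inr k) (.inner (i + 1) ((D.superedge (i + 1)).leftVertex (D.perm i k)))
  | joinLeft (i : ZMod g) (k : Fin 3) (hk : D.perm i k ≠ D.dock (i + 1))
      (hA : D.supervertex (i + 1) = .A) :
      Mate u D (i + 1) (.inl (D.perm i k)) (.inner i ((D.superedge i).rightVertex k))
  | primeLeft (i : ZMod g) (j : Fin 3) (hA : D.supervertex i = .A') (hj : j ≠ D.dock i) :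
      Mate u D i (.inl j) (.prime i j hA hj)
  | primeRight (i : ZMod g) (k : Fin 3) (hA : D.supervertex (i + 1) = .A')
      (hk : D.perm i k ≠ D.dock (i + 1)) :
      Mate u D i (.inr k) (.prime (i + 1) (D.perm i k) hA hk)

variable {G : SimpleGraph V} {σ : Sym2 V → Fin 5} {u : ZMod g → V} {D : SuperpositionData g W}
  {c : ∀ i, MultipoleColoring (D.superedge i).Inner (Fin 3 ⊕ Fin 3)} {μ : ZMod g → Fin 5}

/-- Stated at `i + 1` so that the index of a `joinLeft` can be cancelled; an arbitrary index is not
syntactically a successor. -/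
theorem Mate.cases_add_one {i : ZMod g} {s : Fin 3 ⊕ Fin 3} {y : Vertex V D}
    (h : Mate u D (i + 1) s y) :
    (s = .inl (D.dock (i + 1)) ∧ y = .base (u (i + 1))) ∨
    (∃ k, D.perm (i + 1) k = D.dock (i + 1 + 1) ∧ s = .inr k ∧ y = .base (u (i + 1 + 1))) ∨
    (∃ k, D.perm (i + 1) k ≠ D.dock (i + 1 + 1) ∧ D.supervertex (i + 1 + 1) = .A ∧ s = .inr k ∧
      y = .inner (i + 1 + 1) ((D.superedge (i + 1 + 1)).leftVertex (D.perm (i + 1) k))) ∨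
    (∃ k, D.perm i k ≠ D.dock (i + 1) ∧ D.supervertex (i + 1) = .A ∧ s = .inl (D.perm i k) ∧
      y = .inner i ((D.superedge i).rightVertex k)) ∨
    (∃ j hA hj, s = .inl j ∧ y = .prime (i + 1) j hA hj) ∨
    (∃ k hA hk, s = .inr k ∧ y = .prime (i + 1 + 1) (D.perm (i + 1) k) hA hk) := by
  generalize hn : i + 1 = n at h
  cases h with
  | dockLeft => exact .inl ⟨rfl, rfl⟩
  | dockRight _ k hk => exact .inr (.inl ⟨k, hk, rfl, rfl⟩)
  | joinRight _ k hk hA => exact .inr (.inr (.inl ⟨k, hk, hA, rfl, rfl⟩))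
  | joinLeft i' k hk hA =>
    obtain rfl := add_right_cancel hn
    exact .inr (.inr (.inr (.inl ⟨k, hk, hA, rfl, rfl⟩)))
  | primeLeft _ j hA hj => exact .inr (.inr (.inr (.inr (.inl ⟨j, hA, hj, rfl, rfl⟩))))
  | primeRight _ k hA hk => exact .inr (.inr (.inr (.inr (.inr ⟨k, hA, hk, rfl, rfl⟩))))

theorem Mate.not_inner (hC : IsCycleSeq G u) {i : ZMod g} {s : Fin 3 ⊕ Fin 3}
    {b : (D.superedge i).Inner} : ¬ Mate u D i s (.inner i b) := by
  obtain ⟨i, rfl⟩ : ∃ n, i = n + 1 := ⟨i - 1, by ring⟩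
  intro h
  rcases h.cases_add_one with ⟨-, h⟩ | ⟨k, -, -, h⟩ | ⟨k, -, -, -, h⟩ | ⟨k, -, -, -, h⟩ |
    ⟨j, hA, hj, -, h⟩ | ⟨k, hA, hk, -, h⟩
  · cases h
  · cases h
  · exact hC.add_one_ne _ (Vertex.inner.inj h).1.symm
  · exact hC.add_one_ne _ (Vertex.inner.inj h).1
  · cases h
  · cases h

set_option linter.unusedSimpArgs false in
-- Distinct semiedges of one superedge lead to distinct vertices. Length at least 3 matters: it
-- keeps the superedges before and after ℬ_i different.
theorem Mate.eq_iff (hC : IsCycleSeq G u) {i : ZMod g} {s s' : Fin 3 ⊕ Fin 3} {y y' : Vertex V D}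
    (h : Mate u D i s y) (h' : Mate u D i s' y') : y = y' ↔ s = s' := by
  obtain ⟨i, rfl⟩ : ∃ n, i = n + 1 := ⟨i - 1, by ring⟩
  have h1 := hC.add_one_ne i
  have h2 := hC.add_one_ne (i + 1)
  have h3 := hC.add_one_add_one_ne i
  have hu := hC.injective
  have hl := (D.superedge (i + 1 + 1)).leftVertex_injective
  have hr := (D.superedge i).rightVertex_injective
  rcases h.cases_add_one with ⟨rfl, rfl⟩ | ⟨k, hk, rfl, rfl⟩ | ⟨k, hk, hA, rfl, rfl⟩ |
    ⟨k, hk, hA, rfl, rfl⟩ | ⟨j, hA, hj, rfl, rfl⟩ | ⟨k, hA, hk, rfl, rfl⟩ <;>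
  rcases h'.cases_add_one with ⟨rfl, rfl⟩ | ⟨k', hk', rfl, rfl⟩ | ⟨k', hk', hA', rfl, rfl⟩ |
    ⟨k', hk', hA', rfl, rfl⟩ | ⟨j', hA', hj', rfl, rfl⟩ | ⟨k', hA', hk', rfl, rfl⟩ <;>
  simp [hu.eq_iff, hl.eq_iff, hr.eq_iff, h1, h2, h3, h1.symm, h2.symm, h3.symm] <;>
  first
  | exact (D.perm (i + 1)).injective (hk.trans hk'.symm)
  | grind

end SuperpositionData
end SnarkSuperposition

/-! ### Gluing compatible colorings -/

namespace SnarkSuperposition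
namespace SuperpositionData

variable {V : Type*} {g : ℕ} {W : ZMod g → Type*}

/-- Colorings `c i` of the superedges that, together with `σ` outside `C`, form a normal coloring of
the superposition; `μ i` is the color of the edge inside a supervertex `A'`. -/
structure IsCompatible (G : SimpleGraph V) (σ : Sym2 V → Fin 5) (u : ZMod g → V)
    (D : SuperpositionData g W)
    (c : ∀ i, MultipoleColoring (D.superedge i).Inner (Fin 3 ⊕ Fin 3)) (μ : ZMod g → Fin 5) :
    Prop where
  normal : ∀ i, (D.superedge i).multipole.IsNormal (c i)
  left_mem : ∀ i m, (c i).semi (.inl m) ∈ colorsAt G σ (u i)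
  left_fits : ∀ i m, (D.superedge i).multipole.Fits (c i) (.inl m) ((c i).semi (.inl m))
    (colorsAt G σ (u i))
  right_mem : ∀ i m, (c i).semi (.inr m) ∈ colorsAt G σ (u (i + 1))
  right_fits : ∀ i m, (D.superedge i).multipole.Fits (c i) (.inr m) ((c i).semi (.inr m))
    (colorsAt G σ (u (i + 1)))
  dock : ∀ i k, D.perm i k = D.dock (i + 1) →
    ((c i).semi (.inr k) = σ s(u i, u (i + 1)) ∧
      (c (i + 1)).semi (.inl (D.dock (i + 1))) = σ s(u (i + 1), u (i + 1 + 1))) ∨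
    ((c i).semi (.inr k) = σ s(u (i + 1), u (i + 1 + 1)) ∧
      (c (i + 1)).semi (.inl (D.dock (i + 1))) = σ s(u i, u (i + 1)))
  join : ∀ i k, D.supervertex (i + 1) = .A → D.perm i k ≠ D.dock (i + 1) →
    (c i).semi (.inr k) = (c (i + 1)).semi (.inl (D.perm i k))
  prime : ∀ i k, D.supervertex (i + 1) = .A' → D.perm i k ≠ D.dock (i + 1) →
    (c i).semi (.inr k) ≠ (c (i + 1)).semi (.inl (D.perm i k)) ∧
    μ (i + 1) ∈ colorsAt G σ (u (i + 1)) ∧ μ (i + 1) ≠ (c i).semi (.inr k) ∧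
    μ (i + 1) ≠ (c (i + 1)).semi (.inl (D.perm i k))

variable {G : SimpleGraph V} {σ : Sym2 V → Fin 5} {u : ZMod g → V} {D : SuperpositionData g W}
  {c : ∀ i, MultipoleColoring (D.superedge i).Inner (Fin 3 ⊕ Fin 3)} {μ : ZMod g → Fin 5}

/-- `xy` is an edge of color `k`. -/
def HasColor (G : SimpleGraph V) (σ : Sym2 V → Fin 5) (u : ZMod g → V)
    (D : SuperpositionData g W)
    (c : ∀ i, MultipoleColoring (D.superedge i).Inner (Fin 3 ⊕ Fin 3)) (μ : ZMod g → Fin 5)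
    (x y : Vertex V D) (k : Fin 5) : Prop :=
  ColoredEdge G σ u D c μ x y k ∨ ColoredEdge G σ u D c μ y x k

theorem HasColor.symm {x y : Vertex V D} {k : Fin 5} (h : HasColor G σ u D c μ x y k) :
    HasColor G σ u D c μ y x k := Or.symm h

theorem graph_adj_iff (hC : IsCycleSeq G u) (x y : Vertex V D) :
    (D.graph G u).Adj x y ↔ ∃ k, HasColor G σ u D c μ x y k := by
  have h1 : ∀ x y, Edge G u D x y → ∃ k, ColoredEdge G σ u D c μ x y k := by
    rintro _ _ (⟨v, w, h, hv⟩ | ⟨i, a, b, h⟩ | i | ⟨i, k, hk⟩ | ⟨i, k, hA, hk⟩ | ⟨i, j, hA, hj⟩ |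
      ⟨i, k, hA, hk⟩ | ⟨i, j, j', hA, hj, hj', hjj⟩)
    · exact ⟨_, .outer v w h hv⟩
    · exact ⟨_, .inner i a b h⟩
    · exact ⟨_, .dockLeft i⟩
    · exact ⟨_, .dockRight i k hk⟩
    · exact ⟨_, .join i k hA hk⟩
    · exact ⟨_, .primeLeft i j hA hj⟩
    · exact ⟨_, .primeRight i k hA hk⟩
    · exact ⟨_, .primePrime i j j' hA hj hj' hjj⟩
  have h2 : ∀ x y k, ColoredEdge G σ u D c μ x y k → Edge G u D x y ∧ x ≠ y := by
    rintro _ _ _ (⟨v, w, h, hv⟩ | ⟨i, a, b, h⟩ | i | ⟨i, k, hk⟩ | ⟨i, k, hA, hk⟩ | ⟨i, j, hA, hj⟩ |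
      ⟨i, k, hA, hk⟩ | ⟨i, j, j', hA, hj, hj', hjj⟩)
    · exact ⟨.outer v w h hv, by simpa using h.ne⟩
    · exact ⟨.inner i a b h, by simpa using h.ne⟩
    · exact ⟨.dockLeft i, by simp⟩
    · exact ⟨.dockRight i k hk, by simp⟩
    · exact ⟨.join i k hA hk, fun e => hC.add_one_ne i (Vertex.inner.inj e).1.symm⟩
    · exact ⟨.primeLeft i j hA hj, by simp⟩
    · exact ⟨.primeRight i k hA hk, by simp⟩
    · exact ⟨.primePrime i j j' hA hj hj' hjj, by simpa using hjj⟩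
  rw [graph, SimpleGraph.fromRel_adj]
  constructor
  · rintro ⟨-, h | h⟩
    · exact (h1 _ _ h).imp fun _ => .inl
    · exact (h1 _ _ h).imp fun _ => .inr
  · rintro ⟨k, h | h⟩
    · exact ⟨(h2 _ _ _ h).2, .inl (h2 _ _ _ h).1⟩
    · exact ⟨(h2 _ _ _ h).2.symm, .inr (h2 _ _ _ h).1⟩

theorem HasColor.base_cases {v : V} {y : Vertex V D} {k : Fin 5}
    (h : HasColor G σ u D c μ (.base v) y k) :
    (∃ w, G.Adj v w ∧ (∀ i, s(v, w) ≠ s(u i, u (i + 1))) ∧ y = .base w ∧ k = σ s(v, w)) ∨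
    (∃ i, v = u i ∧ y = .inner i ((D.superedge i).leftVertex (D.dock i)) ∧
      k = (c i).semi (.inl (D.dock i))) ∨
    (∃ i m, v = u (i + 1) ∧ D.perm i m = D.dock (i + 1) ∧
      y = .inner i ((D.superedge i).rightVertex m) ∧ k = (c i).semi (.inr m)) := by
  rcases h with h | h
  · cases h with
    | outer _ w h hv => exact .inl ⟨w, h, hv, rfl, rfl⟩
    | dockLeft i => exact .inr (.inl ⟨i, rfl, rfl, rfl⟩)
  · cases h with
    | outer w _ h hv =>
      exact .inl ⟨w, h.symm, fun i => by rw [Sym2.eq_swap]; exact hv i, rfl, by rw [Sym2.eq_swap]⟩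
    | dockRight i m hm => exact .inr (.inr ⟨i, m, rfl, hm, rfl, rfl⟩)

theorem HasColor.inner_cases (hc : IsCompatible G σ u D c μ) {i : ZMod g}
    {a : (D.superedge i).Inner} {y : Vertex V D} {k : Fin 5}
    (h : HasColor G σ u D c μ (.inner i a) y k) :
    (∃ b, (D.superedge i).multipole.graph.Adj a b ∧ y = .inner i b ∧ k = (c i).edge s(a, b)) ∨
    ∃ s, (D.superedge i).multipole.base s = a ∧ Mate u D i s y ∧ k = (c i).semi s := by
  rcases h with h | h
  · cases h with
    | inner _ _ b h => exact .inl ⟨b, h, rfl, rfl⟩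
    | dockRight _ m hm => exact .inr ⟨.inr m, rfl, .dockRight i m hm, rfl⟩
    | join _ m hA hm => exact .inr ⟨.inr m, rfl, .joinRight i m hm hA, rfl⟩
    | primeRight _ m hA hm => exact .inr ⟨.inr m, rfl, .primeRight i m hA hm, rfl⟩
  · cases h with
    | inner _ b _ h => exact .inl ⟨b, h.symm, rfl, by rw [Sym2.eq_swap]⟩
    | dockLeft i => exact .inr ⟨.inl (D.dock i), rfl, .dockLeft i, rfl⟩
    | join i m hA hm =>
      -- A joined edge takes its color from its right semiedge; `hc.join` identifies it with the
      -- color seen from the left semiedge.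
      exact .inr ⟨.inl (D.perm i m), rfl, .joinLeft i m hm hA, hc.join i m hA hm⟩
    | primeLeft i j hA hj => exact .inr ⟨.inl j, rfl, .primeLeft i j hA hj, rfl⟩

theorem HasColor.of_mate (hc : IsCompatible G σ u D c μ) {i : ZMod g} {s : Fin 3 ⊕ Fin 3}
    {y : Vertex V D} (h : Mate u D i s y) :
    HasColor G σ u D c μ (.inner i ((D.superedge i).multipole.base s)) y ((c i).semi s) := by
  cases h with
  | dockLeft => exact .inr (.dockLeft i)
  | dockRight _ k hk => exact .inl (.dockRight i k hk)
  | joinRight _ k hk hA => exact .inl (.join i k hA hk)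
  | joinLeft i k hk hA => exact .inr (hc.join i k hA hk ▸ .join i k hA hk)
  | primeLeft _ j hA hj => exact .inr (.primeLeft i j hA hj)
  | primeRight _ k hA hk => exact .inl (.primeRight i k hA hk)

theorem fin_three_unique : ∀ {a b l l' : Fin 3}, a ≠ b → l ≠ b → l' ≠ b → a ≠ l → a ≠ l' →
    l = l' := by decide

theorem exists_fin_three_ne : ∀ a b : Fin 3, ∃ j, j ≠ a ∧ j ≠ b := by decide

theorem exists_mate (u : ZMod g → V) (D : SuperpositionData g W) (i : ZMod g)
    (s : Fin 3 ⊕ Fin 3) : ∃ y, Mate u D i s y := by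
  rcases s with j | k
  · by_cases hj : j = D.dock i
    · subst hj; exact ⟨_, .dockLeft i⟩
    · cases hA : D.supervertex i with
      | A =>
        obtain ⟨i, rfl⟩ : ∃ n, i = n + 1 := ⟨i - 1, by ring⟩
        obtain ⟨k, rfl⟩ := (D.perm i).surjective j
        exact ⟨_, .joinLeft i k hj hA⟩
      | A' => exact ⟨_, .primeLeft i j hA hj⟩
  · by_cases hk : D.perm i k = D.dock (i + 1)
    · exact ⟨_, .dockRight i k hk⟩
    · cases hA : D.supervertex (i + 1) with
      | A => exact ⟨_, .joinRight i k hk hA⟩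
      | A' => exact ⟨_, .primeRight i k hA hk⟩

theorem HasColor.prime_cases {i n : ZMod g} (hn : i + 1 = n) {j : Fin 3}
    {hA : D.supervertex n = .A'} {hj : j ≠ D.dock n} {y : Vertex V D} {k : Fin 5}
    (h : HasColor G σ u D c μ (.prime n j hA hj) y k) :
    (y = .inner n ((D.superedge n).leftVertex j) ∧ k = (c n).semi (.inl j)) ∨
    (∃ m, D.perm i m = j ∧ y = .inner i ((D.superedge i).rightVertex m) ∧
      k = (c i).semi (.inr m)) ∨
    ∃ j' hj', j ≠ j' ∧ y = .prime n j' hA hj' ∧ k = μ n := by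
  rcases h with h | h
  · cases h with
    | primeLeft => exact .inl ⟨rfl, rfl⟩
    | primePrime _ _ j' _ _ hj' hjj => exact .inr (.inr ⟨j', hj', hjj, rfl, rfl⟩)
  · cases h with
    | primeRight i' m =>
      obtain rfl := add_right_cancel hn
      exact .inr (.inl ⟨m, rfl, rfl, rfl⟩)
    | primePrime _ j' _ _ hj' _ hjj => exact .inr (.inr ⟨j', hj', hjj.symm, rfl, rfl⟩)

/-- The colors at a vertex of the superposition. -/
def vertexColors (G : SimpleGraph V) (σ : Sym2 V → Fin 5) (u : ZMod g → V)
    (D : SuperpositionData g W)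
    (c : ∀ i, MultipoleColoring (D.superedge i).Inner (Fin 3 ⊕ Fin 3)) :
    Vertex V D → Set (Fin 5)
  | .base v => colorsAt G σ v
  | .inner i a => (D.superedge i).multipole.colorsAt (c i) a
  | .prime i _ _ _ => colorsAt G σ (u i)

theorem mem_vertexColors (hG : IsCubic G) (hσ : IsProperEdgeColoring G σ)
    (hc : IsCompatible G σ u D c μ) (x : Vertex V D) (k : Fin 5) :
    k ∈ vertexColors G σ u D c x ↔ ∃ y, HasColor G σ u D c μ x y k := by
  rcases x with v | ⟨i, a⟩ | ⟨i, j, hA, hj⟩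
  · constructor
    · rintro ⟨w, hw, rfl⟩
      by_cases hv : ∀ i, s(v, w) ≠ s(u i, u (i + 1))
      · exact ⟨_, .inl (.outer v w hw hv)⟩
      -- The two edges of C at u_{i+1} are replaced by the two dock edges, whose colors are the same
      -- pair, possibly exchanged.
      · have key : ∀ i, (∃ y, HasColor G σ u D c μ (.base (u (i + 1))) y (σ s(u i, u (i + 1)))) ∧
            ∃ y, HasColor G σ u D c μ (.base (u (i + 1))) y (σ s(u (i + 1), u (i + 1 + 1))) := by
          intro i
          have hk : D.perm i ((D.perm i).symm (D.dock (i + 1))) = D.dock (i + 1) := by simp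
          have e1 : HasColor G σ u D c μ _ _ _ := .inr (.dockRight i _ hk)
          have e2 : HasColor G σ u D c μ _ _ _ := .inl (.dockLeft (i + 1))
          rcases hc.dock i _ hk with ⟨h1, h2⟩ | ⟨h1, h2⟩ <;> rw [h1] at e1 <;> rw [h2] at e2
          · exact ⟨⟨_, e1⟩, ⟨_, e2⟩⟩
          · exact ⟨⟨_, e2⟩, ⟨_, e1⟩⟩
        push Not at hv
        obtain ⟨i, hi⟩ := hv
        rw [hi]
        rcases Sym2.eq_iff.1 hi with ⟨rfl, -⟩ | ⟨rfl, -⟩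
        · obtain ⟨i, rfl⟩ : ∃ n, i = n + 1 := ⟨i - 1, by ring⟩
          exact (key i).2
        · exact (key i).1
    · rintro ⟨y, h⟩
      rcases h.base_cases with ⟨w, hw, -, -, rfl⟩ | ⟨i, rfl, -, rfl⟩ | ⟨i, m, rfl, -, -, rfl⟩
      · exact ⟨w, hw, rfl⟩
      · exact hc.left_mem i _
      · exact hc.right_mem i _
  · constructor
    · rintro (⟨w, hw, rfl⟩ | ⟨s, rfl, rfl⟩)
      · exact ⟨_, .inl (.inner i a w hw)⟩
      · obtain ⟨y, hy⟩ := exists_mate u D i s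
        exact ⟨y, .of_mate hc hy⟩
    · rintro ⟨y, h⟩
      rcases h.inner_cases hc with ⟨b, hb, -, rfl⟩ | ⟨s, rfl, -, rfl⟩
      · exact .inl ⟨b, hb, rfl⟩
      · exact .inr ⟨s, rfl, rfl⟩
  · obtain ⟨i, rfl⟩ : ∃ n, i = n + 1 := ⟨i - 1, by ring⟩
    obtain ⟨m, rfl⟩ := (D.perm i).surjective j
    obtain ⟨h1, h2, h3, h4⟩ := hc.prime i m hA hj
    constructor
    · intro hk
      -- Three distinct colors inside the triple of u_{i+1} exhaust it, so a subdividing vertex has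
      -- the same colors as u_{i+1}.
      have hsub : {(c i).semi (.inr m), (c (i + 1)).semi (.inl (D.perm i m)), μ (i + 1)} =
          colorsAt G σ (u (i + 1)) := by
        refine Set.eq_of_subset_of_ncard_le ?_ ?_
        · rintro x (rfl | rfl | rfl)
          · exact hc.right_mem i m
          · exact hc.left_mem _ _
          · exact h2
        · rw [hG.ncard_colorsAt hσ, Set.ncard_eq_three.2 ⟨_, _, _, h1, h3.symm, h4.symm, rfl⟩]
      have hk : k ∈ colorsAt G σ (u (i + 1)) := hk
      rw [← hsub] at hk
      rcases hk with rfl | rfl | rfl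
      · exact ⟨_, .inr (.primeRight i m hA hj)⟩
      · exact ⟨_, .inl (.primeLeft (i + 1) _ hA hj)⟩
      · obtain ⟨j', hj', hjj⟩ := exists_fin_three_ne (D.dock (i + 1)) (D.perm i m)
        exact ⟨_, .inl (.primePrime (i + 1) _ j' hA hj hj' hjj.symm)⟩
    · rintro ⟨y, h⟩
      rcases h.prime_cases rfl with ⟨-, rfl⟩ | ⟨m, -, -, rfl⟩ | ⟨j', hj', -, -, rfl⟩
      · exact hc.left_mem _ _
      · exact hc.right_mem _ _
      · exact h2

theorem ncard_vertexColors_union (hG : IsCubic G) (hσ : IsNormalColoring G σ)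
    (hc : IsCompatible G σ u D c μ) {x y : Vertex V D} {k : Fin 5}
    (h : HasColor G σ u D c μ x y k) :
    (vertexColors G σ u D c x ∪ vertexColors G σ u D c y).ncard = 3 ∨
      (vertexColors G σ u D c x ∪ vertexColors G σ u D c y).ncard = 5 := by
  have hT := fun i => hG.ncard_colorsAt hσ.1 (u i)
  suffices key : ∀ x y k, ColoredEdge G σ u D c μ x y k →
      (vertexColors G σ u D c x ∪ vertexColors G σ u D c y).ncard = 3 ∨
        (vertexColors G σ u D c x ∪ vertexColors G σ u D c y).ncard = 5 by
    rcases h with h | h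
    · exact key _ _ _ h
    · rw [union_comm]; exact key _ _ _ h
  rintro _ _ _ (⟨v, w, h, hv⟩ | ⟨i, a, b, h⟩ | i | ⟨i, k, hk⟩ | ⟨i, k, hA, hk⟩ | ⟨i, j, hA, hj⟩ |
    ⟨i, k, hA, hk⟩ | ⟨i, j, j', hA, hj, hj', hjj⟩)
  · exact hσ.2 v w h
  · exact (hc.normal i).2 a b h
  · exact ncard_union_of_fits (hT i) (hc.left_mem i _) (.inl rfl) (hc.left_fits i _).2
  · exact ncard_union_of_fits (hT (i + 1)) (hc.right_mem i _) (hc.right_fits i _).2 (.inl rfl)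
  · refine ncard_union_of_fits (hT (i + 1)) (hc.right_mem i _) (hc.right_fits i _).2 ?_
    rw [hc.join i k hA hk]
    exact (hc.left_fits (i + 1) _).2
  · exact ncard_union_of_fits (hT i) (hc.left_mem i _) (.inl rfl) (hc.left_fits i _).2
  · exact ncard_union_of_fits (hT (i + 1)) (hc.right_mem i _) (hc.right_fits i _).2 (.inl rfl)
  · left
    simp only [vertexColors, union_self]
    exact hT i

/-- One equivalence gives both properness and uniqueness of the color of an edge. At a base vertex
on C it reduces to properness of `σ`, at an inner vertex to properness of `c i`, at a subdividing
vertex to the `prime` condition. -/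
theorem HasColor.eq_iff (hC : IsCycleSeq G u) (hσ : IsProperEdgeColoring G σ)
    (hc : IsCompatible G σ u D c μ) {x y y' : Vertex V D} {k k' : Fin 5}
    (h : HasColor G σ u D c μ x y k) (h' : HasColor G σ u D c μ x y' k') : y = y' ↔ k = k' := by
  rcases x with v | ⟨i, a⟩ | ⟨i, j, hA, hj⟩
  · have hdock : ∀ i m, D.perm i m = D.dock (i + 1) →
        (c i).semi (.inr m) ≠ (c (i + 1)).semi (.inl (D.dock (i + 1))) := by
      intro i m hm
      rcases hc.dock i m hm with ⟨h1, h2⟩ | ⟨h1, h2⟩ <;> rw [h1, h2]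
      · exact hC.color_ne hσ i
      · exact (hC.color_ne hσ i).symm
    have hout : ∀ i w, G.Adj (u (i + 1)) w → (∀ n, s(u (i + 1), w) ≠ s(u n, u (n + 1))) →
        σ s(u (i + 1), w) ≠ σ s(u i, u (i + 1)) ∧
        σ s(u (i + 1), w) ≠ σ s(u (i + 1), u (i + 1 + 1)) := by
      intro i w hw hv
      constructor
      · rw [Sym2.eq_swap (a := u i)]
        refine hσ _ _ _ hw (hC.adj i).symm ?_
        rintro rfl
        exact hv i Sym2.eq_swap
      · refine hσ _ _ _ hw (hC.adj _) ?_
        rintro rfl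
        exact hv _ rfl
    have hoR : ∀ i m, D.perm i m = D.dock (i + 1) → ∀ w, G.Adj (u (i + 1)) w →
        (∀ n, s(u (i + 1), w) ≠ s(u n, u (n + 1))) → σ s(u (i + 1), w) ≠ (c i).semi (.inr m) := by
      intro i m hm w hw hv
      rcases hc.dock i m hm with ⟨h1, h2⟩ | ⟨h1, h2⟩ <;> rw [h1]
      · exact (hout i w hw hv).1
      · exact (hout i w hw hv).2
    have hoL : ∀ i w, G.Adj (u i) w →
        (∀ n, s(u i, w) ≠ s(u n, u (n + 1))) → σ s(u i, w) ≠ (c i).semi (.inl (D.dock i)) := by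
      intro i w hw hv
      obtain ⟨i, rfl⟩ : ∃ n, i = n + 1 := ⟨i - 1, by ring⟩
      rcases hc.dock i ((D.perm i).symm (D.dock (i + 1))) (by simp) with ⟨h1, h2⟩ | ⟨h1, h2⟩ <;>
        rw [h2]
      · exact (hout i w hw hv).2
      · exact (hout i w hw hv).1
    rcases h.base_cases with ⟨w, hw, hv, rfl, rfl⟩ | ⟨i, rfl, rfl, rfl⟩ | ⟨i, m, rfl, hm, rfl, rfl⟩ <;>
    rcases h'.base_cases with ⟨w', hw', hv', rfl, rfl⟩ | ⟨i', hi, rfl, rfl⟩ |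
      ⟨i', m', hi, hm', rfl, rfl⟩
    · constructor
      · intro e; rw [Vertex.base.inj e]
      · intro e; by_contra hne
        exact hσ _ _ _ hw hw' (fun e => hne (e ▸ rfl)) e
    · subst hi
      simpa using hoL i' w hw hv
    · subst hi
      simpa using hoR i' m' hm' w hw hv
    · simpa using (hoL i w' hw' hv').symm
    · obtain rfl := hC.injective hi
      simp
    · obtain rfl := hC.injective hi
      refine iff_of_false (fun e => ?_) (hdock i' m' hm').symm
      exact hC.add_one_ne i' (Vertex.inner.inj e).1
    · simpa using (hoR i m hm w' hw' hv').symm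
    · obtain rfl := hC.injective hi
      refine iff_of_false (fun e => ?_) (hdock i m hm)
      exact hC.add_one_ne i (Vertex.inner.inj e).1.symm
    · obtain rfl := add_right_cancel (hC.injective hi)
      obtain rfl := (D.perm i).injective (hm.trans hm'.symm)
      simp
  · obtain ⟨⟨h1, h2, h3⟩, -⟩ := hc.normal i
    rcases h.inner_cases hc with ⟨b, hb, rfl, rfl⟩ | ⟨s, rfl, hs, rfl⟩ <;>
    rcases h'.inner_cases hc with ⟨b', hb', rfl, rfl⟩ | ⟨s', hs'', hs', rfl⟩
    · constructor
      · intro e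
        simp only [Vertex.inner.injEq, heq_eq_eq, true_and] at e
        rw [e]
      · intro e; by_contra hne
        exact h1 _ _ _ hb hb' (fun e => hne (e ▸ rfl)) e
    · subst hs''
      refine iff_of_false ?_ (h3 s' b hb).symm
      rintro rfl
      exact hs'.not_inner hC
    · refine iff_of_false ?_ (h3 s b' hb')
      rintro rfl
      exact hs.not_inner hC
    · rw [hs.eq_iff hC hs']
      constructor
      · rintro rfl; rfl
      · intro e; by_contra hne
        exact h2 s s' hne hs''.symm e
  · obtain ⟨i, rfl⟩ : ∃ n, i = n + 1 := ⟨i - 1, by ring⟩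
    obtain ⟨m, rfl⟩ := (D.perm i).surjective j
    obtain ⟨h1, h2, h3, h4⟩ := hc.prime i m hA hj
    have hi : ∀ a b, (Vertex.inner i a : Vertex V D) ≠ Vertex.inner (i + 1) b := fun a b e =>
      hC.add_one_ne i (Vertex.inner.inj e).1.symm
    rcases h.prime_cases rfl with ⟨rfl, rfl⟩ | ⟨n, hn, rfl, rfl⟩ | ⟨l, hl, hjl, rfl, rfl⟩ <;>
    rcases h'.prime_cases rfl with ⟨rfl, rfl⟩ | ⟨n', hn', rfl, rfl⟩ | ⟨l', hl', hjl', rfl, rfl⟩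
    · simp
    · obtain rfl := (D.perm i).injective hn'
      exact iff_of_false (hi _ _).symm h1.symm
    · exact iff_of_false (by simp) h4.symm
    · obtain rfl := (D.perm i).injective hn
      exact iff_of_false (hi _ _) h1
    · obtain rfl := (D.perm i).injective hn
      obtain rfl := (D.perm i).injective hn'
      simp
    · obtain rfl := (D.perm i).injective hn
      exact iff_of_false (by simp) h3.symm
    · exact iff_of_false (by simp) h4
    · obtain rfl := (D.perm i).injective hn'
      exact iff_of_false (by simp) h3
    · obtain rfl := fin_three_unique hj hl hl' hjl hjl'
      simp

theorem IsCompatible.exists_isNormalColoring (hG : IsCubic G) (hσ : IsNormalColoring G σ)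
    (hC : IsCycleSeq G u) (hc : IsCompatible G σ u D c μ) :
    ∃ τ : Sym2 (Vertex V D) → Fin 5, IsNormalColoring (D.graph G u) τ :=
  SnarkSuperposition.exists_isNormalColoring (HasColor G σ u D c μ) (vertexColors G σ u D c)
    (fun _ _ _ => HasColor.symm) (graph_adj_iff hC)
    (fun _ _ _ _ _ h h' => h.eq_iff hC hσ.1 hc h') (mem_vertexColors hG hσ.1 hc)
    (fun _ _ _ h => ncard_vertexColors_union hG hσ hc h)

end SuperpositionData
-- Choosing colorings around the cycle
/-- Recursion along a cyclic sequence from `i₀ + 1` to `i₀`. -/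
theorem exists_cyclic_rec {g : ℕ} [NeZero g] {α : Type*} (i₀ : ZMod g) (a : α)
    (f : ZMod g → α → α) :
    ∃ J : ZMod g → α, J (i₀ + 1) = a ∧ ∀ i, i ≠ i₀ → J (i + 1) = f i (J i) := by
  let F : ℕ → α := fun n => Nat.rec a (fun t x => f (i₀ + 1 + t) x) n
  refine ⟨fun i => F (i - (i₀ + 1)).val, by simp [F], fun i hi => ?_⟩
  obtain ⟨d, rfl⟩ : ∃ d, i = i₀ + 1 + d := ⟨i - (i₀ + 1), by ring⟩
  have e1 : i₀ + 1 + d + 1 - (i₀ + 1) = d + 1 := by ring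
  have e2 : i₀ + 1 + d - (i₀ + 1) = d := by ring
  -- The offset from i₀ + 1 wraps around only at i₀, which is excluded.
  have hd : (d + 1).val = d.val + 1 := by
    have hlt := d.val_lt
    have hne : d.val + 1 ≠ g := by
      intro h
      apply hi
      have : d + 1 = 0 := by
        rw [← ZMod.natCast_zmod_val d, ← Nat.cast_succ, Nat.succ_eq_add_one, h, ZMod.natCast_self]
      linear_combination this
    rw [← ZMod.val_natCast_of_lt (show d.val + 1 < g by omega)]
    simp
  simp only [e1, e2, hd]
  change f (i₀ + 1 + (d.val : ZMod g)) (F d.val) = _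
  rw [ZMod.natCast_zmod_val]

theorem Superedge.IsDoublyRight.exists_of_ne {W : Type*} {B : Superedge W} (h : B.IsDoublyRight)
    {d j : Fin 3} (hd : ¬ ∃ c, B.IsRightColoring d c) (hj : j ≠ d) :
    ∃ c, B.IsRightColoring j c := by
  obtain ⟨a, b, hab, ha, hb⟩ := h
  have had : a ≠ d := by rintro rfl; exact hd ha
  have hbd : b ≠ d := by rintro rfl; exact hd hb
  have : j = a ∨ j = b := by
    clear * - hab had hbd hj
    revert a b d j; decide
  rcases this with rfl | rfl <;> assumption

theorem Superedge.IsDoublyLeft.exists_ne {W : Type*} {B : Superedge W} (h : B.IsDoublyLeft)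
    (j d : Fin 3) : ∃ k, k ≠ d ∧ ∃ c, B.IsLeftColoring j k c := by
  obtain ⟨k, k', hk, h1, h2⟩ := h j
  by_cases hd : k = d
  · exact ⟨k', fun e => hk (hd.trans e.symm), h2⟩
  · exact ⟨k, hd, h1⟩

namespace SuperpositionData

variable {V : Type*} {g : ℕ} {W : ZMod g → Type*}
  {G : SimpleGraph V} {σ : Sym2 V → Fin 5} {u : ZMod g → V} {D : SuperpositionData g W}
  {c : ∀ i, MultipoleColoring (D.superedge i).Inner (Fin 3 ⊕ Fin 3)}

/-- The transition at `u_{i+1}` in which the two edges at `u_{i+1}` keep their colors from `G`. -/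
def IsStraight (σ : Sym2 V → Fin 5) (u : ZMod g → V) (D : SuperpositionData g W)
    (c : ∀ i, MultipoleColoring (D.superedge i).Inner (Fin 3 ⊕ Fin 3)) (b : Fin 5)
    (i : ZMod g) : Prop :=
  (∀ k, (c i).semi (.inr k) = σ s(u i, u (i + 1))) ∧
  ∃ x, (D.supervertex (i + 1) = .A → x = σ s(u i, u (i + 1))) ∧
    (D.supervertex (i + 1) = .A' → x = b) ∧
    ∀ m, (c (i + 1)).semi (.inl m) =
      if m = D.dock (i + 1) then σ s(u (i + 1), u (i + 1 + 1)) else x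

/-- The transition at `u_{i+1}` in which the two edges at `u_{i+1}` exchange their colors. -/
def IsCrossed (σ : Sym2 V → Fin 5) (u : ZMod g → V) (D : SuperpositionData g W)
    (c : ∀ i, MultipoleColoring (D.superedge i).Inner (Fin 3 ⊕ Fin 3)) (i : ZMod g) : Prop :=
  ∃ K j, D.perm i K ≠ D.dock (i + 1) ∧ j ≠ D.dock (i + 1) ∧
    (D.supervertex (i + 1) = .A → j ≠ D.perm i K) ∧
    (D.supervertex (i + 1) = .A' → j = D.perm i K) ∧
    (∀ k, (c i).semi (.inr k) =
      if k = K then σ s(u i, u (i + 1)) else σ s(u (i + 1), u (i + 1 + 1))) ∧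
    ∀ m, (c (i + 1)).semi (.inl m) =
      if m = j then σ s(u (i + 1), u (i + 1 + 1)) else σ s(u i, u (i + 1))

theorem mem_colorsAt_left (hC : IsCycleSeq G u) (σ : Sym2 V → Fin 5) (i : ZMod g) :
    σ s(u i, u (i + 1)) ∈ colorsAt G σ (u i) := ⟨_, hC.adj i, rfl⟩

theorem mem_colorsAt_right (hC : IsCycleSeq G u) (σ : Sym2 V → Fin 5) (i : ZMod g) :
    σ s(u i, u (i + 1)) ∈ colorsAt G σ (u (i + 1)) :=
  ⟨_, (hC.adj i).symm, by rw [Sym2.eq_swap]⟩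

theorem exists_isCompatible (hC : IsCycleSeq G u) (hσ : IsProperEdgeColoring G σ)
    {f : ZMod g → Fin 5}
    (hf : ∀ i, f i ∈ colorsAt G σ (u (i + 1)) ∧ f i ≠ σ s(u i, u (i + 1)) ∧
      f i ≠ σ s(u (i + 1), u (i + 1 + 1)))
    (hn : ∀ i, (D.superedge i).multipole.IsNormal (c i))
    (hl : ∀ i m, ∃ a ∈ colorsAt G σ (u i), (D.superedge i).multipole.Fits (c i) (.inl m) a
      (colorsAt G σ (u i)))
    (hr : ∀ i m, ∃ a ∈ colorsAt G σ (u (i + 1)), (D.superedge i).multipole.Fits (c i) (.inr m) a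
      (colorsAt G σ (u (i + 1))))
    (h : ∀ i, IsStraight σ u D c (f i) i ∨ IsCrossed σ u D c i) :
    ∃ μ, IsCompatible G σ u D c μ := by
  have hμ : ∀ i, ∃ x, ∀ k, D.supervertex (i + 1) = .A' → D.perm i k ≠ D.dock (i + 1) →
      (c i).semi (.inr k) ≠ (c (i + 1)).semi (.inl (D.perm i k)) ∧
      x ∈ colorsAt G σ (u (i + 1)) ∧ x ≠ (c i).semi (.inr k) ∧
      x ≠ (c (i + 1)).semi (.inl (D.perm i k)) := by
    intro i
    have hne := hC.color_ne hσ i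
    obtain ⟨hf1, hf2, hf3⟩ := hf i
    rcases h i with ⟨h1, x, -, hx, h2⟩ | ⟨K, j, hK, hj, hA, hA', h1, h2⟩
    -- In a straight A' transition the non-dock right semiedges have the color of u_i u_{i+1} and
    -- the left ones the third color, so the connecting edge gets the remaining color.
    · refine ⟨σ s(u (i + 1), u (i + 1 + 1)), fun k hs hk => ?_⟩
      rw [h1, h2, if_neg hk, hx hs]
      exact ⟨hf2.symm, mem_colorsAt_left hC σ _, hne.symm, hf3.symm⟩
    -- In a crossed A' transition both non-dock lines switch between the two cycle colors, in
    -- opposite directions, so the connecting edge gets the third color.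
    · refine ⟨f i, fun k hs hk => ?_⟩
      rw [h1, h2, hA' hs]
      by_cases hkK : k = K
      · subst hkK
        simpa using ⟨hne, hf1, hf2, hf3⟩
      · simpa [hkK] using ⟨hne.symm, hf1, hf3, hf2⟩
  choose μ hμ using hμ
  -- The color was chosen per transition `i`, which takes place at u_{i+1}; hence the shift.
  refine ⟨fun i => μ (i - 1), hn, fun i m => ?_, fun i m => ?_, fun i m => ?_, fun i m => ?_,
    fun i k hk => ?_, fun i k hA hk => ?_, fun i k hA hk => ?_⟩
  · obtain ⟨a, ha, h⟩ := hl i m; exact h.1 ▸ ha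
  · obtain ⟨a, ha, h⟩ := hl i m; exact h.1.symm ▸ h
  · obtain ⟨a, ha, h⟩ := hr i m; exact h.1 ▸ ha
  · obtain ⟨a, ha, h⟩ := hr i m; exact h.1.symm ▸ h
  · rcases h i with ⟨h1, x, -, -, h2⟩ | ⟨K, j, hK, hj, hA, hA', h1, h2⟩
    · left; rw [h1, h2, if_pos rfl]; exact ⟨rfl, rfl⟩
    · right
      rw [h1, h2, if_neg hj.symm, if_neg (by rintro rfl; exact hK hk)]
      exact ⟨rfl, rfl⟩
  · rcases h i with ⟨h1, x, hx, -, h2⟩ | ⟨K, j, hK, hj, hA1, hA', h1, h2⟩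
    · rw [h1, h2, if_neg hk, hx hA]
    · rw [h1, h2]
      by_cases hkK : k = K
      · subst hkK
        rw [if_pos rfl, if_neg (hA1 hA).symm]
      -- Only two left indices avoid the dock: one receives the exceptional right semiedge `K`, so
      -- the other one is `j`.
      · have : D.perm i k = j := fin_three_unique hK hk hj
          (fun e => hkK ((D.perm i).injective e).symm) (hA1 hA).symm
        rw [if_neg hkK, if_pos this]
  · simpa only [add_sub_cancel_right] using hμ i k hA hk

end SuperpositionData
end SnarkSuperposition

open SnarkSuperposition SuperpositionData

theorem mainTheorem2 {V : Type*} [Finite V] (G : SimpleGraph V)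
    (hG : SnarkSuperposition.IsSnark G)
    (σ : Sym2 V → Fin 5) (hσ : SnarkSuperposition.IsNormalColoring G σ)
    {g : ℕ} (u : ZMod g → V) (hC : SnarkSuperposition.IsCycleSeq G u)
    {W : ZMod g → Type*} [∀ i, Finite (W i)]
    (D : SnarkSuperposition.SuperpositionData g W)
    (hD : ∀ i, (D.superedge i).IsDoublyRight ∧ (D.superedge i).IsDoublyLeft) :
    ∃ τ : Sym2 (SnarkSuperposition.SuperpositionData.Vertex V D) → Fin 5,
      SnarkSuperposition.IsNormalColoring (D.graph G u) τ := by
  have : NeZero g := ⟨by have := hC.three_le; omega⟩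
  have hT := fun i => hG.cubic.ncard_colorsAt hσ.1 (u i)
  have hTT : ∀ i, colorsAt G σ (u (i + 1)) = colorsAt G σ (u i) ∨
      colorsAt G σ (u (i + 1)) = insert (σ s(u i, u (i + 1))) (colorsAt G σ (u i))ᶜ := fun i =>
    eq_or_eq_insert_compl (hT i) (hT (i + 1)) (mem_colorsAt_left hC σ i)
      (mem_colorsAt_right hC σ i) (hσ.2 _ _ (hC.adj i))
  have hne := hC.color_ne hσ.1
  -- The color at u_{i+1} of its edge outside C.
  have hf : ∀ i, ∃ x ∈ colorsAt G σ (u (i + 1)), x ≠ σ s(u i, u (i + 1)) ∧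
      x ≠ σ s(u (i + 1), u (i + 1 + 1)) := by
    intro i
    by_contra! h
    have h1 := Set.ncard_le_ncard (show colorsAt G σ (u (i + 1)) ⊆
      {σ s(u i, u (i + 1)), σ s(u (i + 1), u (i + 1 + 1))} from fun x hx => by
        by_cases hx' : x = σ s(u i, u (i + 1))
        · exact .inl hx'
        · exact .inr (h x hx hx'))
    rw [Set.ncard_pair (hne i), hT] at h1
    omega
  choose f hf using hf
  suffices h : ∃ c : ∀ i, MultipoleColoring (D.superedge i).Inner (Fin 3 ⊕ Fin 3),
      (∀ i, (D.superedge i).multipole.IsNormal (c i)) ∧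
      (∀ i m, ∃ a ∈ colorsAt G σ (u i), (D.superedge i).multipole.Fits (c i) (.inl m) a
        (colorsAt G σ (u i))) ∧
      (∀ i m, ∃ a ∈ colorsAt G σ (u (i + 1)), (D.superedge i).multipole.Fits (c i) (.inr m) a
        (colorsAt G σ (u (i + 1)))) ∧
      ∀ i, IsStraight σ u D c (f i) i ∨ IsCrossed σ u D c i by
    obtain ⟨c, hn, hl, hr, h⟩ := h
    obtain ⟨μ, hμ⟩ := exists_isCompatible hC hσ.1 hf hn hl hr h
    exact hμ.exists_isNormalColoring hG.cubic hσ hC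
  -- The color of the non-dock left semiedges after a straight transition: unchanged through A, the
  -- third color through A'.
  have hb : ∀ i, ∃ x ∈ colorsAt G σ (u (i + 1)), x ≠ σ s(u (i + 1), u (i + 1 + 1)) ∧
      (D.supervertex (i + 1) = .A → x = σ s(u i, u (i + 1))) ∧
      (D.supervertex (i + 1) = .A' → x = f i) := by
    intro i
    cases D.supervertex (i + 1) with
    | A => exact ⟨_, mem_colorsAt_right hC σ i, hne i, by simp, by simp⟩
    | A' => exact ⟨f i, (hf i).1, (hf i).2.2, by simp, by simp⟩
  choose b hbT hbne hbA hbA' using hb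
  by_cases hall : ∀ i, ∃ c, (D.superedge i).IsRightColoring (D.dock i) c
  · have hB : ∀ i, b (i - 1) ∈ colorsAt G σ (u i) ∧ b (i - 1) ≠ σ s(u i, u (i + 1)) := by
      intro i
      obtain ⟨i, rfl⟩ : ∃ n, i = n + 1 := ⟨i - 1, by ring⟩
      rw [add_sub_cancel_right]
      exact ⟨hbT i, hbne i⟩
    have hex := fun i => (hall i).choose_spec.exists_coloring (hT i) (mem_colorsAt_left hC σ i)
      (hB i).1 (hB i).2 (hTT i)
    choose c hn hl hr using hex
    refine ⟨c, hn, fun i m => ⟨_, ?_, hl i m⟩, fun i m => ⟨_, mem_colorsAt_right hC σ i, hr i m⟩,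
      fun i => .inl ⟨fun k => (hr i k).1, b i, hbA i, hbA' i, fun m => ?_⟩⟩
    · split_ifs
      · exact mem_colorsAt_left hC σ i
      · exact (hB i).1
    · rw [(hl (i + 1) m).1, add_sub_cancel_right]
  · push Not at hall
    obtain ⟨i₀, hi₀⟩ := hall
    -- `K i j` is an exceptional right index that misses the dock of u_{i+1}, given the exceptional
    -- left index `j` of ℬ_i.
    choose K hK hKc using fun i j => (hD i).2.exists_ne j ((D.perm i).symm (D.dock (i + 1)))
    have hnext : ∀ i k, k ≠ (D.perm i).symm (D.dock (i + 1)) → ∃ j, j ≠ D.dock (i + 1) ∧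
        (D.supervertex (i + 1) = .A → j ≠ D.perm i k) ∧
        (D.supervertex (i + 1) = .A' → j = D.perm i k) := by
      intro i k hk
      rw [Ne, Equiv.eq_symm_apply] at hk
      cases D.supervertex (i + 1) with
      | A =>
        obtain ⟨j, h1, h2⟩ := exists_fin_three_ne (D.dock (i + 1)) (D.perm i k)
        exact ⟨j, h1, fun _ => h2, by simp⟩
      | A' => exact ⟨_, hk, by simp, by simp⟩
    choose next hnd hnA hnA' using fun i j => hnext i (K i j) (hK i j)
    -- The transition out of i₀ is straight, so the exceptional left index of the next superedge is
    -- its dock; afterwards `next` prescribes the crossed transitions.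
    obtain ⟨J, hJ0, hJ⟩ := exists_cyclic_rec i₀ (D.dock (i₀ + 1)) next
    have hJd : J i₀ ≠ D.dock i₀ := by
      obtain ⟨i, hi⟩ : ∃ n, n + 1 = i₀ := ⟨i₀ - 1, by ring⟩
      have hne : i ≠ i₀ := fun h => hC.add_one_ne i (hi.trans h.symm)
      rw [← hi, hJ i hne]
      exact hnd i _
    -- `B i` is the color of the two non-exceptional left semiedges of ℬ_i: the straight value just
    -- after i₀, and the color of the preceding edge of C elsewhere.
    obtain ⟨B, hBJ, hB0, hB1⟩ : ∃ B : ZMod g → Fin 5,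
        (∀ i, B i ∈ colorsAt G σ (u i) ∧ B i ≠ σ s(u i, u (i + 1))) ∧ B (i₀ + 1) = b i₀ ∧
        ∀ i, i ≠ i₀ → B (i + 1) = σ s(u i, u (i + 1)) := by
      classical
      refine ⟨fun i => if i - 1 = i₀ then b i₀ else σ s(u (i - 1), u i), fun i => ?_, by simp,
        fun i hi => by simp [hi]⟩
      obtain ⟨i, rfl⟩ : ∃ n, i = n + 1 := ⟨i - 1, by ring⟩
      simp only [add_sub_cancel_right]
      split_ifs with h
      · exact h ▸ ⟨hbT i, hbne i⟩
      · exact ⟨mem_colorsAt_right hC σ i, hne i⟩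
    have hex : ∀ i, ∃ c, (D.superedge i).multipole.IsNormal c ∧
        (∀ m, (D.superedge i).multipole.Fits c (.inl m)
          (if m = J i then σ s(u i, u (i + 1)) else B i) (colorsAt G σ (u i))) ∧
        ∀ m, (D.superedge i).multipole.Fits c (.inr m)
          (if i = i₀ ∨ m = K i (J i) then σ s(u i, u (i + 1)) else
            σ s(u (i + 1), u (i + 1 + 1))) (colorsAt G σ (u (i + 1))) := by
      intro i
      by_cases hi : i = i₀
      · subst hi
        -- The recursion returns to i₀ with a non-dock index. As the dock is the index without a
        -- right coloring, this one has one.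
        obtain ⟨c, hc⟩ := (hD i).1.exists_of_ne (not_exists.2 hi₀) hJd
        simpa using hc.exists_coloring (hT i) (mem_colorsAt_left hC σ i) (hBJ i).1 (hBJ i).2 (hTT i)
      · obtain ⟨c, hc⟩ := hKc i (J i)
        simpa [hi] using hc.exists_coloring (hT i) (hT (i + 1)) (mem_colorsAt_left hC σ i)
          (hBJ i).1 (hBJ i).2 (mem_colorsAt_left hC σ (i + 1)) (hne i).symm (hTT i)
    choose c hn hl hr using hex
    refine ⟨c, hn, fun i m => ⟨_, ?_, hl i m⟩, fun i m => ⟨_, ?_, hr i m⟩, fun i => ?_⟩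
    · split_ifs
      · exact mem_colorsAt_left hC σ i
      · exact (hBJ i).1
    · split_ifs
      · exact mem_colorsAt_right hC σ i
      · exact mem_colorsAt_left hC σ (i + 1)
    · by_cases hi : i = i₀
      · subst hi
        refine .inl ⟨fun k => (hr i k).1.trans (if_pos (.inl rfl)), b i, hbA i, hbA' i,
          fun m => ?_⟩
        rw [(hl (i + 1) m).1, hJ0, hB0]
      · refine .inr ⟨K i (J i), J (i + 1), ?_, ?_, ?_, ?_, fun k => ?_, fun m => ?_⟩
        · rw [Ne, ← Equiv.eq_symm_apply]; exact hK i _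
        · rw [hJ i hi]; exact hnd i _
        · rw [hJ i hi]; exact hnA i _
        · rw [hJ i hi]; exact hnA' i _
        · simpa [hi] using (hr i k).1
        · rw [(hl (i + 1) m).1, hB1 i hi]
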